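/- **Setting.** Let $\mathcal G$ be a jump-diffusion operator on $\mathbb R$, $$\mathcal G f(x)=b(x)f'(x)+\tfrac12\sigma^2(x)f''(x)+\int_{\mathbb R}\bigl(f(x+z)-f(x)-f'(x)z\bigr)\,\ell(x,dz),$$ with $b,\sigma:\mathbb R\to\mathbb R$ measurable and $\ell$ a transition kernel on $\mathbb R$ such that $\ell(x,\{0\})=0$ and $\int_{\mathbb R}|z|\wedge|z|^2\,\ell(x,dz)<\infty$ for all $x\in\mathbb R$. Assume that $\mathcal G$ is polynomial: $\int_{\mathbb R}|z|^k\,\ell(x,dz)<\infty$ for all $x\in\mathbb R$ and $k\ge2$, and for each $n\in\mathbb N$ the operator $\mathcal G$ maps the space $\mathrm{Pol}_n(\mathbb R)$ of polynomials of degree at most $n$ to itself. Let $(\Omega,\mathcal F,(\mathcal F_t)_{t\ge0},\mathbb P)$ be a filtered probability space and let $Y$ be a real-valued adapted càdlàg process with $Y(0)=y\in\mathbb R$ almost surely and with extended generator $\mathcal G$, i.e. for every bounded $f\in C^2(\mathbb R)$ the process $f(Y(t))-f(y)-\int_0^t\mathcal Gf(Y(s))\,ds$ is a local martingale. For $n\ge0$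 let $H_n(x)=(1,x,\dots,x^n)^\top$ and $X_n(x)=H_n(x)H_n(x)^\top$, and let the generator matrix $G_n\in\mathbb R^{(n+1)\times(n+1)}$ be the unique matrix with $\mathcal GH_n(x)=G_nH_n(x)$ for all $x\in\mathbb R$, where $\mathcal G$ acts entrywise. Let $vec$ denote the operator that stacks the columns of a matrix, with inverse $vec^{-1}$. With $\vec e_{k,j}$ the $j$-th canonical basis vector of $\mathbb R^k$ and $\otimes$ the Kronecker product, put $$E_{n+1}=\sum_{i=1}^{n+1}\vec e_{2n+1,i}\otimes\vec e_{n+1,1}^{\,\top}\otimes\vec e_{n+1,i}^{\,\top}+\sum_{i=2}^{n+1}\vec e_{2n+1,n+i}\otimes\vec e_{n+1,i}^{\,\top}\otimes\vec e_{n+1,n+1}^{\,\top},\qquad D_{n+1}=\sum_{i=1}^{n+1}\sum_{j=1}^{n+1}\vec e_{2n+1,i+j-1}^{\,\top}\otimes\vec e_{n+1,j}\otimes\vec e_{n+1,i}.$$ **Theorem (two-point correlator formula).** Let $p_0\in\mathrm{Pol}_{n_0}(\mathbb R)$, $p_1\in\mathrm{Pol}_{n_1}(\mathbb R)$, $n=\max\{n_0,n_1\}$,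 let $\vec p_0,\vec p_1\in\mathbb R^{n+1}$ be the vectors of coefficients, so that $p_k(x)=\vec p_k^{\,\top}H_n(x)$, and let $0\le t<s_0<s_1$. Then $p_1(Y(s_0))\,p_0(Y(s_1))$ is integrable and, almost surely, $$\mathbb E\bigl[p_1(Y(s_0))\,p_0(Y(s_1))\,\big|\,\mathcal F_t\bigr]=\vec p_1^{\,\top}\Bigl\{vec^{-1}\circ D_{n+1}e^{G_{2n}(s_0-t)}E_{n+1}\circ vec\bigl(X_n(Y(t))\bigr)\Bigr\}e^{G_n^\top(s_1-s_0)}\,\vec p_0 .$$ -/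

import Mathlib

open MeasureTheory ProbabilityTheory Filter Topology
open scoped NNReal Matrix

noncomputable section

/-- The data of a jump-diffusion operator on `ℝ`: a drift `b`, a volatility `σ` and a transition
kernel `ℓ` of jump sizes with `ℓ(x, {0}) = 0` and `∫ |z| ∧ |z|² ℓ(x, dz) < ∞` for all `x`. -/
structure JumpDiffusionOperator where
  b : ℝ → ℝ
  measurable_b : Measurable b
  σ : ℝ → ℝ
  measurable_σ : Measurable σ
  ℓ : Kernel ℝ ℝ
  ℓ_zero : ∀ x, ℓ x {0} = 0
  integrable_ℓ : ∀ x, Integrable (fun z : ℝ => min |z| (|z| ^ 2)) (ℓ x)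

namespace JumpDiffusionOperator

/-- The action of the operator:
`𝒢 f(x) = b(x) f'(x) + ½ σ²(x) f''(x) + ∫ (f(x + z) - f(x) - f'(x) z) ℓ(x, dz)`. -/
def apply (𝒢 : JumpDiffusionOperator) (f : ℝ → ℝ) (x : ℝ) : ℝ :=
  𝒢.b x * deriv f x + 1 / 2 * 𝒢.σ x ^ 2 * deriv (deriv f) x
    + ∫ z, (f (x + z) - f x - deriv f x * z) ∂(𝒢.ℓ x)

/-- `𝒢` is polynomial: it is well defined on polynomials (all moments of order at least two of the
jump kernel are finite; on the state space `ℝ` the further requirement that `𝒢` annihilates the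
zero function holds by definition) and it maps polynomials of degree at most `n` to polynomials of
degree at most `n`, for each `n`. -/
structure IsPolynomial (𝒢 : JumpDiffusionOperator) : Prop where
  integrable_pow : ∀ x, ∀ k : ℕ, 2 ≤ k → Integrable (fun z : ℝ => |z| ^ k) (𝒢.ℓ x)
  mapsTo_degreeLE : ∀ n : ℕ, ∀ p ∈ Polynomial.degreeLE ℝ n, ∃ q ∈ Polynomial.degreeLE ℝ n,
    ∀ x, 𝒢.apply (fun u => p.eval u) x = q.eval x

end JumpDiffusionOperator

/-- The vector of monomials `H_n(x) = (1, x, …, xⁿ)`. -/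
def monomialVec (n : ℕ) (x : ℝ) : Fin (n + 1) → ℝ := fun i => x ^ (i : ℕ)

/-- The vector of coefficients in `ℝ^(n+1)` of a polynomial of degree at most `n`. -/
def coeffVec (n : ℕ) (p : Polynomial ℝ) : Fin (n + 1) → ℝ := fun i => p.coeff i

/-- The Hankel matrix `X_n(x) = H_n(x) H_n(x)ᵀ`. -/
def hankelMatrix (n : ℕ) (x : ℝ) : Matrix (Fin (n + 1)) (Fin (n + 1)) ℝ :=
  Matrix.vecMulVec (monomialVec n x) (monomialVec n x)

namespace JumpDiffusionOperator

theorem IsPolynomial.exists_generatorMatrix {𝒢 : JumpDiffusionOperator} (h : 𝒢.IsPolynomial)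
    (n : ℕ) : ∃ G : Matrix (Fin (n + 1)) (Fin (n + 1)) ℝ,
      ∀ x, (fun i : Fin (n + 1) => 𝒢.apply (fun u => u ^ (i : ℕ)) x) = G *ᵥ monomialVec n x := by
  have key : ∀ i : Fin (n + 1), ∃ q ∈ Polynomial.degreeLE ℝ n,
      ∀ x, 𝒢.apply (fun u => u ^ (i : ℕ)) x = q.eval x := by
    intro i
    have := h.mapsTo_degreeLE n (Polynomial.X ^ (i : ℕ)) (by
      rw [Polynomial.mem_degreeLE, Polynomial.degree_X_pow]
      exact_mod_cast Nat.lt_succ_iff.mp i.2)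
    simpa using this
  choose q hq hqx using key
  refine ⟨Matrix.of fun i j => (q i).coeff j, fun x => funext fun i => ?_⟩
  have hd : (q i).natDegree < n + 1 :=
    Nat.lt_succ_iff.mpr (Polynomial.natDegree_le_of_degree_le (Polynomial.mem_degreeLE.mp (hq i)))
  rw [hqx, Polynomial.eval_eq_sum_range' hd, ← Fin.sum_univ_eq_sum_range
    (fun j => (q i).coeff j * x ^ j)]
  rfl

/-- The generator matrix `G_n` of a polynomial operator: the matrix with `𝒢 H_n(x) = G_n H_n(x)`
for all `x`. -/
def generatorMatrix {𝒢 : JumpDiffusionOperator} (h : 𝒢.IsPolynomial) (n : ℕ) :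
    Matrix (Fin (n + 1)) (Fin (n + 1)) ℝ :=
  (h.exists_generatorMatrix n).choose

theorem generatorMatrix_mulVec {𝒢 : JumpDiffusionOperator} (h : 𝒢.IsPolynomial) (n : ℕ) (x : ℝ) :
    (fun i : Fin (n + 1) => 𝒢.apply (fun u => u ^ (i : ℕ)) x)
      = generatorMatrix h n *ᵥ monomialVec n x :=
  (h.exists_generatorMatrix n).choose_spec x

/-- The generator matrix is the only matrix with its defining property. -/
theorem eq_generatorMatrix {𝒢 : JumpDiffusionOperator} (h : 𝒢.IsPolynomial) (n : ℕ)
    (G : Matrix (Fin (n + 1)) (Fin (n + 1)) ℝ)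
    (hG : ∀ x, (fun i : Fin (n + 1) => 𝒢.apply (fun u => u ^ (i : ℕ)) x)
      = G *ᵥ monomialVec n x) : G = generatorMatrix h n := by
  have aux : ∀ v w : Fin (n + 1) → ℝ,
      (∀ x, v ⬝ᵥ monomialVec n x = w ⬝ᵥ monomialVec n x) → v = w := by
    intro v w hvw
    have hp : (∑ i : Fin (n + 1), Polynomial.monomial (i : ℕ) (v i) : Polynomial ℝ)
        = ∑ i : Fin (n + 1), Polynomial.monomial (i : ℕ) (w i) := by
      refine Polynomial.funext fun x => ?_
      simpa [Polynomial.eval_finsetSum, dotProduct, monomialVec] using hvw x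
    funext i
    have := congrArg (fun p => Polynomial.coeff p (i : ℕ)) hp
    simpa [Polynomial.finsetSum_coeff, Polynomial.coeff_monomial, Fin.val_inj] using this
  funext i
  refine aux _ _ fun x => ?_
  exact congrFun ((hG x).symm.trans (generatorMatrix_mulVec h n x)) i

end JumpDiffusionOperator

/-- `Y` is an adapted càdlàg process which starts in `y` and has extended generator `𝒢`: for every
bounded `f` of class `C²`, the process `f(Y(t)) - f(y) - ∫₀ᵗ 𝒢 f(Y(s)) ds` is a local martingale.
Here `P` plays the role of `ℙ_y`. -/
structure IsJumpDiffusion {Ω : Type*} {mΩ : MeasurableSpace Ω} (𝒢 : JumpDiffusionOperator)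
    (P : Measure Ω) (ℱ : Filtration ℝ≥0 mΩ) (Y : ℝ≥0 → Ω → ℝ) (y : ℝ) : Prop where
  stronglyAdapted : StronglyAdapted ℱ Y
  right_continuous : ∀ ω t, ContinuousWithinAt (fun s => Y s ω) (Set.Ici t) t
  left_limits : ∀ ω t, ∃ l : ℝ, Tendsto (fun s => Y s ω) (𝓝[<] t) (𝓝 l)
  initial : ∀ᵐ ω ∂P, Y 0 ω = y
  local_martingale : ∀ f : ℝ → ℝ, ContDiff ℝ 2 f → (∃ C, ∀ x, |f x| ≤ C) →
    Locally (fun M => Martingale M ℱ P) ℱ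
      (fun t ω => f (Y t ω) - f y - ∫ s in (0 : ℝ)..t, 𝒢.apply f (Y s.toNNReal ω)) P

/-- The inverse `vec⁻¹` of the vectorization `Matrix.vec`, which stacks the columns of a matrix.
Entries of `vec A` are indexed by pairs (column, row), in place of `n (j - 1) + i`. -/
def vecInv {m n : ℕ} (v : Fin n × Fin m → ℝ) : Matrix (Fin m) (Fin n) ℝ :=
  Matrix.of fun i j => v (j, i)

theorem vecInv_vec {m n : ℕ} (A : Matrix (Fin m) (Fin n) ℝ) : vecInv A.vec = A := rfl

/-- The L-eliminating matrix `E_{n+1}`, which sends `vec A` to the first column of `A` followed by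
the last row of `A` without its first entry. A Kronecker product `e_k ⊗ e_jᵀ ⊗ e_iᵀ` of canonical
basis vectors is the matrix unit in row `k` and column `(j, i)`. -/
def elimMatrix (n : ℕ) : Matrix (Fin (2 * n + 1)) (Fin (n + 1) × Fin (n + 1)) ℝ :=
  (∑ i : Fin (n + 1), Matrix.single (⟨i, by omega⟩ : Fin (2 * n + 1)) (0, i) 1)
    + ∑ i : Fin n, Matrix.single (⟨n + 1 + i, by omega⟩ : Fin (2 * n + 1)) (i.succ, Fin.last n) 1

/-- The L-duplicating matrix `D_{n+1}`, the sum of the matrix units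
`e_{i+j-1}ᵀ ⊗ e_j ⊗ e_i` for `1 ≤ i, j ≤ n + 1`. -/
def dupMatrix (n : ℕ) : Matrix (Fin (n + 1) × Fin (n + 1)) (Fin (2 * n + 1)) ℝ :=
  ∑ i : Fin (n + 1), ∑ j : Fin (n + 1),
    Matrix.single (j, i) (⟨i + j, by omega⟩ : Fin (2 * n + 1)) 1

end

/-!
Since `𝒢 (1 + x²)ᵏ ≤ c (1 + x²)ᵏ`, the moments of `Y` grow at most exponentially: local martingales
are available for bounded test functions only, but dividing `v = (1 + x²)ᵏ` by `1 + v / (m + 1)`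
makes it bounded and, by the maximum principle, preserves the inequality, so Grönwall's lemma
applies uniformly in `m`. With these moments as dominating functions, damping and localization can
both be removed and Dynkin's formula holds for every `C²` function of polynomial growth. For the
monomials it says that, for `A` in `ℱ s`, the vector `∫_A H_n(Y(t)) dP` solves the linear ODE
`u' = G_n u` on `[s, ∞)`, whence `E[H_n(Y(t)) | ℱ s] = exp((t - s) G_n) H_n(Y(s))`.

For the two-point formula, condition on `ℱ s₀` first: what remains is a quadratic form in
`H_n(Y(s₀))`. The duplicating matrix turns it into a linear form in `H_{2n}(Y(s₀))`, to which the
moment formula applies once more.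
-/

/-! ### Functions of class `C²` with polynomial growth -/

theorem one_le_one_add_sq (x : ℝ) : 1 ≤ 1 + x ^ 2 := le_add_of_nonneg_right (sq_nonneg x)

theorem one_add_add_sq_le (x z : ℝ) : 1 + (x + z) ^ 2 ≤ 2 * (1 + x ^ 2) * (1 + z ^ 2) := by
  nlinarith [sq_nonneg (x - z), sq_nonneg (x * z)]

theorem abs_pow_le_one_add_sq_pow (x : ℝ) {i d : ℕ} (h : i ≤ 2 * d) :
    |x ^ i| ≤ (1 + x ^ 2) ^ d := by
  refine abs_le_of_sq_le_sq ?_ (by positivity)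
  calc (x ^ i) ^ 2 = (x ^ 2) ^ i := by ring
    _ ≤ (1 + x ^ 2) ^ i := by gcongr; linarith
    _ ≤ (1 + x ^ 2) ^ (2 * d) := by gcongr; exact one_le_one_add_sq x
    _ = ((1 + x ^ 2) ^ d) ^ 2 := by ring

theorem exists_abs_eval_le (p : Polynomial ℝ) :
    ∃ C, 0 ≤ C ∧ ∀ d, p.natDegree ≤ 2 * d → ∀ x, |p.eval x| ≤ C * (1 + x ^ 2) ^ d := by
  refine ⟨∑ i ∈ Finset.range (p.natDegree + 1), |p.coeff i|, by positivity, fun d hd x => ?_⟩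
  rw [Polynomial.eval_eq_sum_range, Finset.sum_mul]
  refine (Finset.abs_sum_le_sum_abs _ _).trans (Finset.sum_le_sum fun i hi => ?_)
  rw [abs_mul]
  gcongr
  exact abs_pow_le_one_add_sq_pow x (by have := Finset.mem_range.1 hi; omega)

theorem abs_sub_sub_deriv_mul_le {f : ℝ → ℝ} {x z B : ℝ} (hf : Differentiable ℝ f)
    (hf' : Differentiable ℝ (deriv f))
    (hB : ∀ y ∈ Set.uIcc x (x + z), |deriv (deriv f) y| ≤ B) :
    |f (x + z) - f x - deriv f x * z| ≤ B * z ^ 2 := by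
  have hderiv : ∀ y ∈ Set.uIcc x (x + z), ‖deriv f y - deriv f x‖ ≤ B * |z| := fun y hy => by
    refine ((convex_uIcc x (x + z)).norm_image_sub_le_of_norm_deriv_le
      (fun v _ => hf' v) hB Set.left_mem_uIcc hy).trans ?_
    have := (abs_nonneg _).trans (hB y hy)
    gcongr
    simpa using Set.abs_sub_left_of_mem_uIcc hy
  have hlin : ∀ y ∈ Set.uIcc x (x + z),
      HasDerivWithinAt (fun y => f y - deriv f x * y) (deriv f y - deriv f x)
        (Set.uIcc x (x + z)) y := fun y _ => by
    simpa using ((hf y).hasDerivAt.fun_sub ((hasDerivAt_id y).const_mul _)).hasDerivWithinAt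
  have h := (convex_uIcc x (x + z)).norm_image_sub_le_of_norm_hasDerivWithin_le hlin hderiv
    Set.left_mem_uIcc Set.right_mem_uIcc
  calc |f (x + z) - f x - deriv f x * z|
      = |f (x + z) - deriv f x * (x + z) - (f x - deriv f x * x)| := by congr 1; ring
    _ ≤ B * |z| * |x + z - x| := h
    _ = B * z ^ 2 := by rw [add_sub_cancel_left, mul_assoc, ← sq, sq_abs]

/-- Functions of class `C²` which are bounded, together with their first two derivatives, by
`C (1 + x²)ᵈ`: the test functions on which a polynomial jump-diffusion operator acts. -/
structure HasC2Growth (f : ℝ → ℝ) (C : ℝ) (d : ℕ) : Prop where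
  contDiff : ContDiff ℝ 2 f
  abs_le : ∀ x, |f x| ≤ C * (1 + x ^ 2) ^ d
  abs_deriv_le : ∀ x, |deriv f x| ≤ C * (1 + x ^ 2) ^ d
  abs_deriv_deriv_le : ∀ x, |deriv (deriv f) x| ≤ C * (1 + x ^ 2) ^ d

namespace HasC2Growth

variable {f g : ℝ → ℝ} {C C' : ℝ} {d d' : ℕ}

theorem nonneg (hf : HasC2Growth f C d) : 0 ≤ C := by
  simpa using (abs_nonneg _).trans (hf.abs_le 0)

theorem differentiable (hf : HasC2Growth f C d) : Differentiable ℝ f :=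
  hf.contDiff.differentiable two_ne_zero

theorem differentiable_deriv (hf : HasC2Growth f C d) : Differentiable ℝ (deriv f) :=
  (contDiff_succ_iff_deriv.1
    (one_add_one_eq_two (R := WithTop ℕ∞) ▸ hf.contDiff)).2.2.differentiable one_ne_zero

theorem continuous_deriv_deriv (hf : HasC2Growth f C d) : Continuous (deriv (deriv f)) := by
  simpa only [iteratedDeriv_succ, iteratedDeriv_zero] using
    hf.contDiff.continuous_iteratedDeriv 2 le_rfl

theorem const_mul (hf : HasC2Growth f C d) (a : ℝ) :
    HasC2Growth (fun x => a * f x) (|a| * C) d := by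
  have hderiv : ∀ g : ℝ → ℝ, deriv (fun x => a * g x) = fun x => a * deriv g x := fun g =>
    funext fun x => deriv_const_mul_field a
  have hmul : ∀ {x b : ℝ}, |b| ≤ C * (1 + x ^ 2) ^ d → |a * b| ≤ |a| * C * (1 + x ^ 2) ^ d :=
    fun hb => by
      rw [abs_mul, mul_assoc]
      gcongr
  refine ⟨contDiff_const.mul hf.contDiff, fun x => hmul (hf.abs_le x), fun x => ?_, fun x => ?_⟩
  · rw [hderiv]
    exact hmul (hf.abs_deriv_le x)
  · rw [hderiv, hderiv]
    exact hmul (hf.abs_deriv_deriv_le x)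

theorem deriv_mul_eq (hf : HasC2Growth f C d) (hg : HasC2Growth g C' d') :
    deriv (fun x => f x * g x) = fun x => deriv f x * g x + f x * deriv g x :=
  funext fun x => deriv_fun_mul (hf.differentiable x) (hg.differentiable x)

theorem deriv_deriv_mul_eq (hf : HasC2Growth f C d) (hg : HasC2Growth g C' d') (x : ℝ) :
    deriv (deriv fun x => f x * g x) x
      = deriv (deriv f) x * g x + 2 * (deriv f x * deriv g x) + f x * deriv (deriv g) x := by
  have hf' := hf.differentiable
  have hg' := hg.differentiable
  have hf'' := hf.differentiable_deriv
  have hg'' := hg.differentiable_deriv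
  rw [hf.deriv_mul_eq hg, deriv_fun_add (by fun_prop) (by fun_prop),
    deriv_fun_mul (by fun_prop) (by fun_prop), deriv_fun_mul (by fun_prop) (by fun_prop)]
  ring

theorem mul (hf : HasC2Growth f C d) (hg : HasC2Growth g C' d') :
    HasC2Growth (fun x => f x * g x) (4 * C * C') (d + d') := by
  have hCC' : 0 ≤ C * C' := mul_nonneg hf.nonneg hg.nonneg
  have hmul : ∀ {x a b : ℝ}, |a| ≤ C * (1 + x ^ 2) ^ d → |b| ≤ C' * (1 + x ^ 2) ^ d' →
      |a * b| ≤ C * C' * (1 + x ^ 2) ^ (d + d') := fun {x a b} ha hb => by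
    rw [abs_mul, pow_add, mul_mul_mul_comm]
    exact mul_le_mul ha hb (abs_nonneg b) ((abs_nonneg a).trans ha)
  have hB : ∀ x : ℝ, 0 ≤ C * C' * (1 + x ^ 2) ^ (d + d') := fun x => by positivity
  refine ⟨hf.contDiff.mul hg.contDiff, fun x => ?_, fun x => ?_, fun x => ?_⟩
  · linarith [hmul (hf.abs_le x) (hg.abs_le x), hB x]
  · rw [hf.deriv_mul_eq hg]
    refine (abs_add_le _ _).trans ?_
    linarith [hmul (hf.abs_deriv_le x) (hg.abs_le x), hmul (hf.abs_le x) (hg.abs_deriv_le x), hB x]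
  · rw [hf.deriv_deriv_mul_eq hg]
    refine (abs_add_three _ _ _).trans ?_
    rw [abs_mul 2, abs_two]
    linarith [hmul (hf.abs_deriv_deriv_le x) (hg.abs_le x),
      hmul (hf.abs_deriv_le x) (hg.abs_deriv_le x), hmul (hf.abs_le x) (hg.abs_deriv_deriv_le x)]

theorem abs_taylor_le (hf : HasC2Growth f C d) (x z : ℝ) :
    |f (x + z) - f x - deriv f x * z|
      ≤ C * 2 ^ d * (1 + x ^ 2) ^ d * (z ^ 2 * (1 + z ^ 2) ^ d) := by
  have hC := hf.nonneg
  have hbound : ∀ y ∈ Set.uIcc x (x + z),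
      |deriv (deriv f) y| ≤ C * (2 * (1 + x ^ 2) * (1 + z ^ 2)) ^ d := fun y hy => by
    have hyz : (y - x) ^ 2 ≤ z ^ 2 :=
      sq_le_sq.2 (by simpa using Set.abs_sub_left_of_mem_uIcc hy)
    have hy' := one_add_add_sq_le x (y - x)
    rw [add_sub_cancel] at hy'
    refine (hf.abs_deriv_deriv_le y).trans ?_
    gcongr
    exact hy'.trans (by gcongr)
  refine (abs_sub_sub_deriv_mul_le hf.differentiable hf.differentiable_deriv hbound).trans_eq ?_
  rw [mul_pow, mul_pow]
  ring

end HasC2Growth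

theorem deriv_eval (p : Polynomial ℝ) :
    deriv (fun x => p.eval x) = fun x => p.derivative.eval x :=
  funext fun _ => p.deriv

theorem exists_hasC2Growth_eval (p : Polynomial ℝ) :
    ∃ C, ∀ d, p.natDegree ≤ 2 * d → HasC2Growth (fun x => p.eval x) C d := by
  obtain ⟨C₀, h₀, hC₀⟩ := exists_abs_eval_le p
  obtain ⟨C₁, h₁, hC₁⟩ := exists_abs_eval_le p.derivative
  obtain ⟨C₂, h₂, hC₂⟩ := exists_abs_eval_le p.derivative.derivative
  refine ⟨C₀ + C₁ + C₂, fun d hd => ?_⟩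
  have hd₁ : p.derivative.natDegree ≤ 2 * d := p.natDegree_derivative_le.trans (by omega)
  have hd₂ : p.derivative.derivative.natDegree ≤ 2 * d :=
    p.derivative.natDegree_derivative_le.trans (by omega)
  refine ⟨p.contDiff_aeval 2, fun x => (hC₀ d hd x).trans (by gcongr; linarith), ?_, ?_⟩
  · rw [deriv_eval]
    exact fun x => (hC₁ d hd₁ x).trans (by gcongr; linarith)
  · rw [deriv_eval, deriv_eval]
    exact fun x => (hC₂ d hd₂ x).trans (by gcongr; linarith)

theorem exists_hasC2Growth_pow (i : ℕ) : ∃ C, HasC2Growth (fun x => x ^ i) C i := by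
  obtain ⟨C, hC⟩ := exists_hasC2Growth_eval (Polynomial.X ^ i)
  refine ⟨C, ?_⟩
  simpa using hC i (by rw [Polynomial.natDegree_X_pow]; omega)

theorem natDegree_one_add_X_sq_pow_le (k : ℕ) :
    ((1 + Polynomial.X ^ 2) ^ k : Polynomial ℝ).natDegree ≤ 2 * k := by
  rw [mul_comm]
  exact Polynomial.natDegree_pow_le_of_le k (by compute_degree)

theorem exists_hasC2Growth_one_add_sq_pow (k : ℕ) :
    ∃ C, HasC2Growth (fun x => (1 + x ^ 2) ^ k) C k := by
  obtain ⟨C, hC⟩ := exists_hasC2Growth_eval ((1 + Polynomial.X ^ 2) ^ k)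
  exact ⟨C, by simpa using hC k (natDegree_one_add_X_sq_pow_le k)⟩

/-- The factor `(1 + v / (m + 1))⁻¹`. For a nonnegative function `v` of polynomial growth, it
increases to `1` as `m → ∞`, and multiplication by it makes every function dominated by `v`
bounded, while the growth of the first two derivatives remains controlled uniformly in `m`. -/
noncomputable def damping (v : ℝ → ℝ) (m : ℕ) (x : ℝ) : ℝ := (1 + v x / (m + 1))⁻¹

section Damping

variable {v : ℝ → ℝ} {C : ℝ} {d : ℕ}

theorem damping_pos (hv₀ : ∀ x, 0 ≤ v x) (m : ℕ) (x : ℝ) : 0 < damping v m x := by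
  have := hv₀ x
  unfold damping
  positivity

theorem damping_le_one (hv₀ : ∀ x, 0 ≤ v x) (m : ℕ) (x : ℝ) : damping v m x ≤ 1 :=
  inv_le_one_of_one_le₀ (le_add_of_nonneg_right (div_nonneg (hv₀ x) (by positivity)))

theorem abs_damping_pow_le_one (hv₀ : ∀ x, 0 ≤ v x) (m : ℕ) (x : ℝ) (i : ℕ) :
    |damping v m x ^ i| ≤ 1 := by
  rw [abs_of_pos (pow_pos (damping_pos hv₀ m x) i)]
  exact pow_le_one₀ (damping_pos hv₀ m x).le (damping_le_one hv₀ m x)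

theorem abs_div_mul_damping_pow_le (hv₀ : ∀ x, 0 ≤ v x) (m : ℕ) (x a : ℝ) (i : ℕ) :
    |a / (m + 1) * damping v m x ^ i| ≤ |a| := by
  rw [abs_mul, abs_div, abs_of_pos (by positivity : (0 : ℝ) < m + 1)]
  exact (mul_le_of_le_one_right (by positivity) (abs_damping_pow_le_one hv₀ m x i)).trans
    (div_le_self (abs_nonneg a) (by simp))

theorem mul_damping_le (hv₀ : ∀ x, 0 ≤ v x) (m : ℕ) (x : ℝ) : v x * damping v m x ≤ m + 1 := by
  have := hv₀ x
  rw [damping, ← div_eq_mul_inv, div_le_iff₀ (by positivity), mul_add,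
    mul_div_cancel₀ _ (by positivity)]
  linarith [m.cast_nonneg (α := ℝ)]

theorem tendsto_damping (v : ℝ → ℝ) (x : ℝ) :
    Tendsto (fun m => damping v m x) atTop (𝓝 1) := by
  have h := (tendsto_one_div_add_atTop_nhds_zero_nat (𝕜 := ℝ)).const_mul (v x)
  simpa [damping, div_eq_mul_inv] using (h.const_add 1).inv₀ (by simp)

-- The tangent line inequality for the concave function `u ↦ u / (1 + u / (m + 1))`.
theorem mul_damping_sub_le (hv₀ : ∀ x, 0 ≤ v x) (m : ℕ) (x y : ℝ) :
    v y * damping v m y - v x * damping v m x ≤ damping v m x ^ 2 * (v y - v x) := by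
  have hx := hv₀ x
  have hy := hv₀ y
  have hdiff : damping v m x ^ 2 * (v y - v x) - (v y * damping v m y - v x * damping v m x)
      = damping v m x ^ 2 * damping v m y * ((v y - v x) ^ 2 / (m + 1)) := by
    unfold damping
    field_simp
    ring
  have hpos := damping_pos hv₀ m y
  rw [← sub_nonneg, hdiff]
  positivity

theorem hasDerivAt_damping (hv₀ : ∀ x, 0 ≤ v x) {x v' : ℝ} (hv : HasDerivAt v v' x) (m : ℕ) :
    HasDerivAt (damping v m) (-(v' / (m + 1) * damping v m x ^ 2)) x := by
  have := hv₀ x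
  refine (((hv.div_const ((m : ℝ) + 1)).const_add 1).fun_inv (by positivity)).congr_deriv ?_
  rw [damping, inv_pow, div_eq_mul_inv, neg_mul]

variable (hv : HasC2Growth v C d) (hv₀ : ∀ x, 0 ≤ v x)
include hv hv₀

theorem deriv_damping (m : ℕ) :
    deriv (damping v m) = fun x => -(deriv v x / (m + 1) * damping v m x ^ 2) :=
  funext fun x => (hasDerivAt_damping hv₀ (hv.differentiable x).hasDerivAt m).deriv

theorem deriv_deriv_damping (m : ℕ) (x : ℝ) :
    deriv (deriv (damping v m)) x = 2 * (deriv v x / (m + 1)) ^ 2 * damping v m x ^ 3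
      - deriv (deriv v) x / (m + 1) * damping v m x ^ 2 := by
  rw [deriv_damping hv hv₀]
  refine ((((hv.differentiable_deriv x).hasDerivAt.div_const _).mul
    ((hasDerivAt_damping hv₀ (hv.differentiable x).hasDerivAt m).pow 2)).neg.congr_deriv ?_).deriv
  simp only [Pi.pow_apply, Nat.cast_ofNat]
  ring

theorem tendsto_deriv_damping (x : ℝ) :
    Tendsto (fun m => deriv (damping v m) x) atTop (𝓝 0) := by
  simp only [deriv_damping hv hv₀, div_eq_mul_inv]
  have h := (tendsto_one_div_add_atTop_nhds_zero_nat (𝕜 := ℝ)).const_mul (deriv v x)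
  simpa using (h.mul ((tendsto_damping v x).pow 2)).neg

theorem tendsto_deriv_deriv_damping (x : ℝ) :
    Tendsto (fun m => deriv (deriv (damping v m)) x) atTop (𝓝 0) := by
  simp only [deriv_deriv_damping hv hv₀, div_eq_mul_inv]
  have h := (tendsto_one_div_add_atTop_nhds_zero_nat (𝕜 := ℝ))
  simpa using
    ((((h.const_mul (deriv v x)).pow 2).const_mul 2).mul ((tendsto_damping v x).pow 3)).sub
    ((h.const_mul (deriv (deriv v) x)).mul ((tendsto_damping v x).pow 2))

theorem hasC2Growth_damping (m : ℕ) :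
    HasC2Growth (damping v m) (1 + C + 2 * C ^ 2) (2 * d) := by
  have hC := hv.nonneg
  have hle : ∀ {x a : ℝ} (i : ℕ), |a| ≤ C * (1 + x ^ 2) ^ d →
      |a / (m + 1) * damping v m x ^ i| ≤ C * (1 + x ^ 2) ^ (2 * d) := fun {x a} i ha => by
    refine (abs_div_mul_damping_pow_le hv₀ m x a i).trans (ha.trans ?_)
    gcongr
    exacts [one_le_one_add_sq x, by omega]
  have hsq : ∀ x, |(deriv v x / (m + 1)) ^ 2 * damping v m x ^ 3|
      ≤ C ^ 2 * (1 + x ^ 2) ^ (2 * d) := fun x => by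
    have hfirst := abs_div_mul_damping_pow_le hv₀ m x (deriv v x) 1
    have hpow := abs_damping_pow_le_one hv₀ m x 1
    calc |(deriv v x / (m + 1)) ^ 2 * damping v m x ^ 3|
        = |deriv v x / (m + 1) * damping v m x ^ 1| ^ 2 * |damping v m x ^ 1| := by
          rw [← abs_pow, ← abs_mul]
          congr 1
          ring
      _ ≤ (C * (1 + x ^ 2) ^ d) ^ 2 := by
          refine (mul_le_of_le_one_right (by positivity) hpow).trans ?_
          gcongr
          exact hfirst.trans (hv.abs_deriv_le x)
      _ = C ^ 2 * (1 + x ^ 2) ^ (2 * d) := by ring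
  have hweaken : ∀ {x a K : ℝ}, K ≤ 1 + C + 2 * C ^ 2 → |a| ≤ K * (1 + x ^ 2) ^ (2 * d) →
      |a| ≤ (1 + C + 2 * C ^ 2) * (1 + x ^ 2) ^ (2 * d) := fun hK ha => ha.trans (by gcongr)
  refine ⟨?_, fun x => ?_, fun x => ?_, fun x => ?_⟩
  · exact (contDiff_const.add (hv.contDiff.div_const _)).inv fun x => by
      have := hv₀ x
      positivity
  · refine hweaken (K := 1) (by nlinarith) ?_
    rw [one_mul]
    simpa using (abs_damping_pow_le_one hv₀ m x 1).trans (one_le_pow₀ (one_le_one_add_sq x))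
  · rw [deriv_damping hv hv₀, abs_neg]
    exact hweaken (by nlinarith) (hle 2 (hv.abs_deriv_le x))
  · rw [deriv_deriv_damping hv hv₀, mul_assoc]
    refine hweaken (K := 2 * C ^ 2 + C) (by linarith) ((abs_sub _ _).trans ?_)
    rw [abs_mul, abs_two]
    linarith [hsq x, hle 2 (hv.abs_deriv_deriv_le x)]

theorem tendsto_deriv_mul_damping {f : ℝ → ℝ} {C' : ℝ} {d' : ℕ} (hf : HasC2Growth f C' d')
    (x : ℝ) : Tendsto (fun m => deriv (fun y => f y * damping v m y) x) atTop (𝓝 (deriv f x)) := by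
  simp only [hf.deriv_mul_eq (hasC2Growth_damping hv hv₀ _)]
  simpa using ((tendsto_damping v x).const_mul (deriv f x)).add
    ((tendsto_deriv_damping hv hv₀ x).const_mul (f x))

theorem tendsto_deriv_deriv_mul_damping {f : ℝ → ℝ} {C' : ℝ} {d' : ℕ} (hf : HasC2Growth f C' d')
    (x : ℝ) : Tendsto (fun m => deriv (deriv fun y => f y * damping v m y) x) atTop
      (𝓝 (deriv (deriv f) x)) := by
  simp only [hf.deriv_deriv_mul_eq (hasC2Growth_damping hv hv₀ _)]
  simpa using (((tendsto_damping v x).const_mul (deriv (deriv f) x)).add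
    (((tendsto_deriv_damping hv hv₀ x).const_mul (deriv f x)).const_mul 2)).add
    ((tendsto_deriv_deriv_damping hv hv₀ x).const_mul (f x))

end Damping

/-! ### Polynomial jump-diffusion operators -/

theorem deriv_deriv_nonpos_of_isLocalMax {f : ℝ → ℝ} {x : ℝ} (hf : ContinuousAt f x)
    (hmax : IsLocalMax f x) : deriv (deriv f) x ≤ 0 := by
  by_contra! hpos
  have hmin := isLocalMin_of_deriv_deriv_pos hpos hmax.deriv_eq_zero hf
  have hconst : f =ᶠ[𝓝 x] fun _ => f x := by
    filter_upwards [hmin, hmax] with y h₁ h₂ using le_antisymm h₂ h₁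
  simp [hconst.deriv.deriv_eq] at hpos

namespace JumpDiffusionOperator

variable {𝒢 : JumpDiffusionOperator}

theorem apply_const_mul (𝒢 : JumpDiffusionOperator) (a : ℝ) (f : ℝ → ℝ) (x : ℝ) :
    𝒢.apply (fun y => a * f y) x = a * 𝒢.apply f x := by
  have hderiv : ∀ g : ℝ → ℝ, deriv (fun y => a * g y) = fun y => a * deriv g y := fun g =>
    funext fun y => deriv_const_mul_field a
  simp only [apply, hderiv, mul_add, ← integral_const_mul]
  congr 1
  · ring
  · exact integral_congr_ae (ae_of_all _ fun z => by ring)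

namespace IsPolynomial

theorem integrable_sq_mul_eval (h : 𝒢.IsPolynomial) (x : ℝ) (p : Polynomial ℝ) :
    Integrable (fun z : ℝ => z ^ 2 * p.eval z) (𝒢.ℓ x) := by
  simp only [Polynomial.eval_eq_sum_range, Finset.mul_sum]
  refine integrable_finsetSum _ fun i _ => ?_
  refine (((h.integrable_pow x (i + 2) (by omega)).mono (by fun_prop)
    (ae_of_all _ fun z => ?_)).const_mul (p.coeff i) :
      Integrable (fun z => _ * z ^ (i + 2)) _).congr
    (ae_of_all _ fun z => by ring)
  simp

theorem integrable_sq_mul_pow (h : 𝒢.IsPolynomial) (x : ℝ) (d : ℕ) :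
    Integrable (fun z : ℝ => z ^ 2 * (1 + z ^ 2) ^ d) (𝒢.ℓ x) := by
  refine (h.integrable_sq_mul_eval x ((1 + Polynomial.X ^ 2) ^ d)).congr (ae_of_all _ fun z => ?_)
  simp

theorem integrable_taylor (h : 𝒢.IsPolynomial) {f : ℝ → ℝ} {C : ℝ} {d : ℕ}
    (hf : HasC2Growth f C d) (x : ℝ) :
    Integrable (fun z => f (x + z) - f x - deriv f x * z) (𝒢.ℓ x) := by
  have := hf.contDiff.continuous
  exact ((h.integrable_sq_mul_pow x d).const_mul _).mono'
    (Continuous.aestronglyMeasurable (by fun_prop)) (ae_of_all _ fun z => hf.abs_taylor_le x z)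

theorem apply_add (h : 𝒢.IsPolynomial) {f g : ℝ → ℝ} {C C' : ℝ} {d d' : ℕ}
    (hf : HasC2Growth f C d) (hg : HasC2Growth g C' d') (x : ℝ) :
    𝒢.apply (fun y => f y + g y) x = 𝒢.apply f x + 𝒢.apply g x := by
  have hderiv : deriv (fun y => f y + g y) = fun y => deriv f y + deriv g y :=
    funext fun y => deriv_fun_add (hf.differentiable y) (hg.differentiable y)
  have hderiv' := deriv_fun_add (hf.differentiable_deriv x) (hg.differentiable_deriv x)
  have hint := integral_add (h.integrable_taylor hf x) (h.integrable_taylor hg x)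
  have hcongr : ∫ z, (f (x + z) + g (x + z) - (f x + g x) - (deriv f x + deriv g x) * z) ∂(𝒢.ℓ x)
      = ∫ z, (f (x + z) - f x - deriv f x * z + (g (x + z) - g x - deriv g x * z)) ∂(𝒢.ℓ x) :=
    integral_congr_ae (ae_of_all _ fun z => by ring)
  simp only [apply, hderiv, hderiv', hcongr, hint]
  ring

/-- The linear form `p ↦ 𝒢 p(x)` on polynomials. -/
noncomputable def applyPolynomial (h : 𝒢.IsPolynomial) (x : ℝ) : Polynomial ℝ →ₗ[ℝ] ℝ where
  toFun p := 𝒢.apply (fun y => p.eval y) x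
  map_add' p q := by
    obtain ⟨C, hp⟩ := exists_hasC2Growth_eval p
    obtain ⟨C', hq⟩ := exists_hasC2Growth_eval q
    simpa using h.apply_add (hp p.natDegree (by omega)) (hq q.natDegree (by omega)) x
  map_smul' a p := by simpa using 𝒢.apply_const_mul a (fun y => p.eval y) x

theorem applyPolynomial_apply (h : 𝒢.IsPolynomial) (x : ℝ) (p : Polynomial ℝ) :
    h.applyPolynomial x p = 𝒢.apply (fun y => p.eval y) x := rfl

theorem exists_apply_eval_eq (h : 𝒢.IsPolynomial) (p : Polynomial ℝ) :
    ∃ q : Polynomial ℝ, q.natDegree ≤ p.natDegree ∧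
      ∀ x, 𝒢.apply (fun y => p.eval y) x = q.eval x := by
  obtain ⟨q, hq, hqx⟩ := h.mapsTo_degreeLE p.natDegree p
    (Polynomial.mem_degreeLE.2 Polynomial.degree_le_natDegree)
  exact ⟨q, Polynomial.natDegree_le_of_degree_le (Polynomial.mem_degreeLE.1 hq), hqx⟩

open Polynomial in
theorem exists_applyPolynomial_mul_comp_eq (h : 𝒢.IsPolynomial) (p r : ℝ[X]) :
    ∃ q : ℝ[X], ∀ x, h.applyPolynomial x (p * r.comp (X - C x)) = q.eval x := by
  induction r using Polynomial.induction_on generalizing p with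
  | C a =>
    obtain ⟨q, -, hq⟩ := h.exists_apply_eval_eq (p * C a)
    exact ⟨q, fun x => by rw [C_comp]; exact hq x⟩
  | add r₁ r₂ h₁ h₂ =>
    obtain ⟨q₁, hq₁⟩ := h₁ p
    obtain ⟨q₂, hq₂⟩ := h₂ p
    exact ⟨q₁ + q₂, fun x => by rw [add_comp, mul_add, map_add, hq₁, hq₂, eval_add]⟩
  | monomial k a ih =>
    obtain ⟨q₁, hq₁⟩ := ih (p * X)
    obtain ⟨q₂, hq₂⟩ := ih p
    refine ⟨q₁ - X * q₂, fun x => ?_⟩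
    have hsplit : p * (C a * X ^ (k + 1)).comp (X - C x)
        = p * X * (C a * X ^ k).comp (X - C x) - x • (p * (C a * X ^ k).comp (X - C x)) := by
      simp only [mul_comp, C_comp, pow_comp, X_comp, smul_eq_C_mul]
      ring
    rw [hsplit, map_sub, map_smul, hq₁, hq₂, eval_sub, eval_mul, eval_X, smul_eq_mul]

-- On a polynomial in `y - x` with a double zero at `y = x`, the drift and the compensator of the
-- jumps vanish at `x`, so that only `σ` and the moments of `ℓ` are seen.
open Polynomial in
theorem applyPolynomial_sq_mul_comp (h : 𝒢.IsPolynomial) (x : ℝ) (s : ℝ[X]) :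
    h.applyPolynomial x ((X ^ 2 * s).comp (X - C x))
      = 𝒢.σ x ^ 2 * s.eval 0 + ∫ z, z ^ 2 * s.eval z ∂(𝒢.ℓ x) := by
  rw [applyPolynomial_apply, apply, deriv_eval, deriv_eval]
  simp [derivative_comp, derivative_mul, derivative_pow, -map_sub]
  ring

open Polynomial in
theorem exists_sq_add_integral_eq_eval (h : 𝒢.IsPolynomial) (d : ℕ) :
    ∃ q : ℝ[X], ∀ x, 𝒢.σ x ^ 2 + ∫ z, z ^ 2 * (1 + z ^ 2) ^ d ∂(𝒢.ℓ x) = q.eval x := by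
  obtain ⟨q, hq⟩ := h.exists_applyPolynomial_mul_comp_eq 1 (X ^ 2 * (1 + X ^ 2) ^ d)
  refine ⟨q, fun x => ?_⟩
  rw [← hq, one_mul, h.applyPolynomial_sq_mul_comp]
  simp

theorem exists_b_eq_eval (h : 𝒢.IsPolynomial) : ∃ q : Polynomial ℝ, ∀ x, 𝒢.b x = q.eval x := by
  obtain ⟨q, -, hq⟩ := h.exists_apply_eval_eq Polynomial.X
  refine ⟨q, fun x => ?_⟩
  rw [← hq, apply, deriv_eval, deriv_eval]
  simp

theorem abs_apply_le (h : 𝒢.IsPolynomial) {f : ℝ → ℝ} {C : ℝ} {d : ℕ}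
    (hf : HasC2Growth f C d) (x : ℝ) :
    |𝒢.apply f x| ≤ C * 2 ^ d * (1 + x ^ 2) ^ d *
      (|𝒢.b x| + (𝒢.σ x ^ 2 + ∫ z, z ^ 2 * (1 + z ^ 2) ^ d ∂(𝒢.ℓ x))) := by
  have hC := hf.nonneg
  have hle : C * (1 + x ^ 2) ^ d ≤ C * 2 ^ d * (1 + x ^ 2) ^ d := by
    gcongr
    exact le_mul_of_one_le_right hC (one_le_pow₀ one_le_two)
  have hdrift : |𝒢.b x * deriv f x| ≤ C * 2 ^ d * (1 + x ^ 2) ^ d * |𝒢.b x| := by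
    rw [abs_mul, mul_comm]
    gcongr
    exact (hf.abs_deriv_le x).trans hle
  have hdiff : |1 / 2 * 𝒢.σ x ^ 2 * deriv (deriv f) x|
      ≤ C * 2 ^ d * (1 + x ^ 2) ^ d * 𝒢.σ x ^ 2 := by
    rw [abs_mul, mul_comm, abs_of_nonneg (by positivity : 0 ≤ 1 / 2 * 𝒢.σ x ^ 2)]
    gcongr
    · exact (hf.abs_deriv_deriv_le x).trans hle
    · linarith [sq_nonneg (𝒢.σ x)]
  have hjump : |∫ z, (f (x + z) - f x - deriv f x * z) ∂(𝒢.ℓ x)|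
      ≤ C * 2 ^ d * (1 + x ^ 2) ^ d * ∫ z, z ^ 2 * (1 + z ^ 2) ^ d ∂(𝒢.ℓ x) := by
    rw [← integral_const_mul]
    exact norm_integral_le_of_norm_le
      (f := fun z => f (x + z) - f x - deriv f x * z)
      ((h.integrable_sq_mul_pow x d).const_mul _) (ae_of_all _ fun z => hf.abs_taylor_le x z)
  rw [mul_add, mul_add, ← add_assoc]
  exact (abs_add_three _ _ _).trans (by gcongr)

theorem exists_abs_apply_le (h : 𝒢.IsPolynomial) (d : ℕ) :
    ∃ K N, 0 ≤ K ∧ ∀ f C, HasC2Growth f C d → ∀ x, |𝒢.apply f x| ≤ C * K * (1 + x ^ 2) ^ N := by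
  obtain ⟨q, hq⟩ := h.exists_b_eq_eval
  obtain ⟨r, hr⟩ := h.exists_sq_add_integral_eq_eval d
  obtain ⟨K, hK, hKq⟩ := exists_abs_eval_le q
  obtain ⟨K', hK', hKr⟩ := exists_abs_eval_le r
  refine ⟨2 ^ d * (K + K'), d + (q.natDegree + r.natDegree), by positivity, fun f C hf x => ?_⟩
  have hC := hf.nonneg
  refine (h.abs_apply_le hf x).trans ?_
  calc _ ≤ C * 2 ^ d * (1 + x ^ 2) ^ d * (K * (1 + x ^ 2) ^ (q.natDegree + r.natDegree)
        + K' * (1 + x ^ 2) ^ (q.natDegree + r.natDegree)) := by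
        rw [hq, hr]
        gcongr
        · exact hKq _ (by omega) x
        · exact (le_abs_self _).trans (hKr _ (by omega) x)
    _ = _ := by ring

theorem apply_le_apply_of_sub_le (h : 𝒢.IsPolynomial) {f g : ℝ → ℝ} {C C' : ℝ} {d d' : ℕ}
    (hf : HasC2Growth f C d) (hg : HasC2Growth g C' d') {x : ℝ}
    (hfg : ∀ y, f y - f x ≤ g y - g x) : 𝒢.apply f x ≤ 𝒢.apply g x := by
  have hmax : IsLocalMax (fun y => f y - g y) x := Eventually.of_forall fun y => by
    linarith [hfg y]
  have hderiv : deriv (fun y => f y - g y) = fun y => deriv f y - deriv g y :=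
    funext fun y => deriv_fun_sub (hf.differentiable y) (hg.differentiable y)
  have hfirst : deriv f x = deriv g x := by
    simpa only [hderiv, sub_eq_zero] using hmax.deriv_eq_zero
  have hsecond : deriv (deriv f) x ≤ deriv (deriv g) x := by
    have := deriv_deriv_nonpos_of_isLocalMax
      ((hf.differentiable x).fun_sub (hg.differentiable x)).continuousAt hmax
    rwa [hderiv, deriv_fun_sub (hf.differentiable_deriv x) (hg.differentiable_deriv x),
      sub_nonpos] at this
  have hjump : ∫ z, (f (x + z) - f x - deriv f x * z) ∂(𝒢.ℓ x)
      ≤ ∫ z, (g (x + z) - g x - deriv g x * z) ∂(𝒢.ℓ x) :=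
    integral_mono (h.integrable_taylor hf x) (h.integrable_taylor hg x) fun z => by
      rw [hfirst]
      linarith [hfg (x + z)]
  unfold apply
  rw [hfirst] at hjump ⊢
  gcongr

theorem tendsto_apply (h : 𝒢.IsPolynomial) {F : ℕ → ℝ → ℝ} {f : ℝ → ℝ} {C : ℝ} {d : ℕ}
    (hF : ∀ m, HasC2Growth (F m) C d) {x : ℝ}
    (h₀ : ∀ y, Tendsto (fun m => F m y) atTop (𝓝 (f y)))
    (h₁ : Tendsto (fun m => deriv (F m) x) atTop (𝓝 (deriv f x)))
    (h₂ : Tendsto (fun m => deriv (deriv (F m)) x) atTop (𝓝 (deriv (deriv f) x))) :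
    Tendsto (fun m => 𝒢.apply (F m) x) atTop (𝓝 (𝒢.apply f x)) := by
  refine ((h₁.const_mul _).add (h₂.const_mul _)).add ?_
  exact tendsto_integral_of_dominated_convergence _
    (fun m => (h.integrable_taylor (hF m) x).aestronglyMeasurable)
    ((h.integrable_sq_mul_pow x d).const_mul _)
    (fun m => ae_of_all _ fun z => (hF m).abs_taylor_le x z)
    (ae_of_all _ fun z => ((h₀ _).sub (h₀ _)).sub (h₁.mul_const z))

theorem continuous_integral_taylor (h : 𝒢.IsPolynomial) {f : ℝ → ℝ} {C : ℝ} {d : ℕ}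
    (hf : HasC2Growth f C d) (x : ℝ) :
    Continuous fun a => ∫ z, (f (a + z) - f a - deriv f a * z) ∂(𝒢.ℓ x) := by
  have hC := hf.nonneg
  have hc := hf.differentiable.continuous
  have hc' := hf.differentiable_deriv.continuous
  refine continuous_iff_continuousAt.2 fun a => ?_
  have hbound : ∀ᶠ a' in 𝓝 a, (1 + a' ^ 2) ^ d ≤ (1 + a ^ 2) ^ d + 1 :=
    (ContinuousAt.tendsto (f := fun a : ℝ => (1 + a ^ 2) ^ d) (by fun_prop)).eventually_le_const
      (lt_add_one _)
  refine continuousAt_of_dominated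
    (bound := fun z => C * 2 ^ d * ((1 + a ^ 2) ^ d + 1) * (z ^ 2 * (1 + z ^ 2) ^ d))
    (Eventually.of_forall fun a' => Continuous.aestronglyMeasurable (by fun_prop))
    (hbound.mono fun a' ha' => ae_of_all _ fun z => (hf.abs_taylor_le a' z).trans (by gcongr))
    ((h.integrable_sq_mul_pow x d).const_mul _)
    (ae_of_all _ fun z => Continuous.continuousAt (by fun_prop))

theorem measurable_apply (h : 𝒢.IsPolynomial) {f : ℝ → ℝ} {C : ℝ} {d : ℕ}
    (hf : HasC2Growth f C d) : Measurable (𝒢.apply f) := by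
  have hc := hf.differentiable.continuous
  have hjump : Measurable (Function.uncurry fun a x =>
      ∫ z, (f (a + z) - f a - deriv f a * z) ∂(𝒢.ℓ x)) :=
    measurable_uncurry_of_continuous_of_measurable (h.continuous_integral_taylor hf) fun a =>
      (StronglyMeasurable.integral_kernel
        (f := fun z => f (a + z) - f a - deriv f a * z)
        (Continuous.stronglyMeasurable (by fun_prop))).measurable
  exact ((𝒢.measurable_b.mul hf.differentiable_deriv.continuous.measurable).add
    (((𝒢.measurable_σ.pow_const 2).const_mul _).mul hf.continuous_deriv_deriv.measurable)).add
    (hjump.comp (measurable_id.prodMk measurable_id))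

end IsPolynomial

end JumpDiffusionOperator

/-! ### Càdlàg paths, Grönwall's inequality and local martingales -/

theorem exists_norm_le_of_rightContinuous_of_leftLimits {ι E : Type*}
    [ConditionallyCompleteLinearOrder ι] [TopologicalSpace ι] [OrderTopology ι]
    [SeminormedAddCommGroup E] {f : ι → E} (hr : ∀ t, ContinuousWithinAt f (Set.Ici t) t)
    (hl : ∀ t, ∃ l, Tendsto f (𝓝[<] t) (𝓝 l)) (a b : ι) : ∃ B, ∀ s ∈ Set.Icc a b, ‖f s‖ ≤ B := by
  refine isCompact_Icc.induction_on (p := fun S => ∃ B, ∀ s ∈ S, ‖f s‖ ≤ B) ⟨0, by simp⟩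
    (fun S S' hS ⟨B, hB⟩ => ⟨B, fun s hs => hB s (hS hs)⟩)
    (fun S S' ⟨B, hB⟩ ⟨B', hB'⟩ => ⟨max B B', fun s hs => hs.elim
      (fun h => (hB s h).trans (le_max_left _ _)) fun h => (hB' s h).trans (le_max_right _ _)⟩)
    fun t _ => ?_
  obtain ⟨l, hl⟩ := hl t
  have hnhds : IsBoundedUnder (· ≤ ·) (𝓝 t) fun s => ‖f s‖ := by
    rw [← nhdsLT_sup_nhdsGE t, IsBoundedUnder, map_sup]
    exact isBounded_sup hl.norm.isBoundedUnder_le (hr t).norm.isBoundedUnder_le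
  obtain ⟨B, hB⟩ := hnhds
  exact ⟨_, mem_nhdsWithin_of_mem_nhds (eventually_map.1 hB), B, fun s hs => hs⟩

theorem le_floor_add_one_div (x : ℝ) (m : ℕ) : x ≤ ((⌊x * (m + 1)⌋ : ℝ) + 1) / (m + 1) := by
  rw [le_div_iff₀ (by positivity)]
  exact (Int.lt_floor_add_one (x * (m + 1))).le

theorem tendsto_floor_add_one_div (x : ℝ) :
    Tendsto (fun m : ℕ => ((⌊x * (m + 1)⌋ : ℝ) + 1) / (m + 1)) atTop (𝓝[≥] x) := by
  refine tendsto_nhdsWithin_iff.2 ⟨?_, Eventually.of_forall (le_floor_add_one_div x)⟩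
  have hupper : Tendsto (fun m : ℕ => x + 1 / ((m : ℝ) + 1)) atTop (𝓝 x) := by
    simpa using tendsto_one_div_add_atTop_nhds_zero_nat.const_add x
  refine tendsto_of_tendsto_of_tendsto_of_le_of_le tendsto_const_nhds hupper
    (le_floor_add_one_div x) fun m => ?_
  have hm : (0 : ℝ) < m + 1 := by positivity
  rw [div_le_iff₀ hm, add_mul, one_div_mul_cancel hm.ne']
  gcongr
  exact Int.floor_le _

theorem measurable_uncurry_of_rightContinuous {Ω E : Type*} [MeasurableSpace Ω]
    [TopologicalSpace E] [TopologicalSpace.PseudoMetrizableSpace E] [MeasurableSpace E]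
    [BorelSpace E] {X : ℝ → Ω → E} (hX : ∀ t, Measurable (X t))
    (hr : ∀ ω t, ContinuousWithinAt (fun s => X s ω) (Set.Ici t) t) :
    Measurable (Function.uncurry X) := by
  refine measurable_of_tendsto_metrizable
    (f := fun (m : ℕ) (q : ℝ × Ω) => X (((⌊q.1 * (m + 1)⌋ : ℝ) + 1) / (m + 1)) q.2) (fun m => ?_)
    (tendsto_pi_nhds.2 fun q => (hr q.2 q.1).tendsto.comp (tendsto_floor_add_one_div q.1))
  have hgrid : Measurable fun q : ℤ × Ω => X (((q.1 : ℝ) + 1) / ((m : ℝ) + 1)) q.2 :=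
    measurable_from_prod_countable_right fun k => hX (((k : ℝ) + 1) / ((m : ℝ) + 1))
  exact hgrid.comp ((Int.measurable_floor.comp (measurable_fst.mul_const _)).prodMk measurable_snd)

theorem hasDerivWithinAt_integral_of_rightContinuous {E : Type*} [NormedAddCommGroup E]
    [NormedSpace ℝ E] [CompleteSpace E] {u : ℝ → E} {s t r : ℝ}
    (hi : IntervalIntegrable u volume s t) (hr : r ∈ Set.Ico s t)
    (hc : ContinuousWithinAt u (Set.Ici r) r) :
    HasDerivWithinAt (fun r => ∫ x in s..r, u x) (u r) (Set.Ici r) r := by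
  refine intervalIntegral.integral_hasDerivWithinAt_right (hi.mono_set ?_)
    ⟨Set.Ioc r t, Ioc_mem_nhdsGT hr.2, ?_⟩ (hc.mono Set.Ioi_subset_Ici_self)
  · rw [Set.uIcc_of_le hr.1, Set.uIcc_of_le (hr.1.trans hr.2.le)]
    exact Set.Icc_subset_Icc_right hr.2.le
  · exact hi.1.aestronglyMeasurable.mono_measure
      (Measure.restrict_mono (Set.Ioc_subset_Ioc_left hr.1) le_rfl)

theorem le_mul_exp_of_le_add_integral {u : ℝ → ℝ} {a c s t : ℝ} (hst : s ≤ t) (hc : 0 ≤ c)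
    (hr : ∀ r ∈ Set.Ico s t, ContinuousWithinAt u (Set.Ici r) r)
    (hi : IntervalIntegrable u volume s t)
    (hu : ∀ r ∈ Set.Icc s t, u r ≤ a + c * ∫ x in s..r, u x) :
    u t ≤ a * Real.exp (c * (t - s)) := by
  have hcont : ContinuousOn (fun r => a + c * ∫ x in s..r, u x) (Set.Icc s t) := by
    rw [← Set.uIcc_of_le hst]
    exact ((intervalIntegral.continuousOn_primitive_interval'
      hi Set.left_mem_uIcc).const_mul c).const_add a
  have hgronwall := le_gronwallBound_of_liminf_deriv_right_le (K := c) (ε := 0) hcont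
    (fun r hr' x hx => by simpa [slope_def_field, div_eq_inv_mul] using
      (((hasDerivWithinAt_integral_of_rightContinuous hi hr' (hr r hr')).const_mul c).const_add
        a).liminf_right_slope_le hx) le_rfl
    (fun r hr' => by
      rw [add_zero]
      exact mul_le_mul_of_nonneg_left (hu r (Set.Ico_subset_Icc_self hr')) hc) t ⟨hst, le_rfl⟩
  refine (hu t ⟨hst, le_rfl⟩).trans (hgronwall.trans_eq ?_)
  rw [gronwallBound_ε0, intervalIntegral.integral_same, mul_zero, add_zero]

section Integrals

variable {Ω : Type*} {mΩ : MeasurableSpace Ω} {P : Measure Ω}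

theorem integrable_and_integral_le_of_tendsto {X : ℕ → Ω → ℝ} {Z : Ω → ℝ} {c : ℝ}
    (hX : ∀ k, Integrable (X k) P) (hX₀ : ∀ k, 0 ≤ᵐ[P] X k) (hc : ∀ k, ∫ ω, X k ω ∂P ≤ c)
    (hlim : ∀ᵐ ω ∂P, Tendsto (fun k => X k ω) atTop (𝓝 (Z ω))) :
    Integrable Z P ∧ ∫ ω, Z ω ∂P ≤ c := by
  have hZm : AEStronglyMeasurable Z P :=
    aestronglyMeasurable_of_tendsto_ae atTop (fun k => (hX k).aestronglyMeasurable) hlim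
  have hZ₀ : 0 ≤ᵐ[P] Z := by
    filter_upwards [hlim, ae_all_iff.2 hX₀] with ω hω h₀ using ge_of_tendsto' hω h₀
  have hnorm : ∀ k, ∫⁻ ω, ‖X k ω‖ₑ ∂P ≤ ENNReal.ofReal c := fun k => by
    rw [← ofReal_integral_norm_eq_lintegral_enorm (hX k)]
    refine ENNReal.ofReal_le_ofReal (le_of_eq_of_le (integral_congr_ae ?_) (hc k))
    filter_upwards [hX₀ k] with ω hω using Real.norm_of_nonneg hω
  have hfatou : ∫⁻ ω, ‖Z ω‖ₑ ∂P ≤ ENNReal.ofReal c := by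
    calc ∫⁻ ω, ‖Z ω‖ₑ ∂P = ∫⁻ ω, liminf (fun k => ‖X k ω‖ₑ) atTop ∂P :=
          lintegral_congr_ae (hlim.mono fun ω hω => hω.enorm.liminf_eq.symm)
      _ ≤ liminf (fun k => ∫⁻ ω, ‖X k ω‖ₑ ∂P) atTop :=
          lintegral_liminf_le' fun k => (hX k).aestronglyMeasurable.enorm
      _ ≤ ENNReal.ofReal c := liminf_le_of_frequently_le' (Frequently.of_forall hnorm)
  refine ⟨⟨hZm, hfatou.trans_lt ENNReal.ofReal_lt_top⟩, ?_⟩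
  rw [integral_eq_lintegral_of_nonneg_ae hZ₀ hZm]
  refine ENNReal.toReal_le_of_le_ofReal ((integral_nonneg_of_ae (hX₀ 0)).trans (hc 0)) ?_
  refine le_of_eq_of_le (lintegral_congr_ae ?_) hfatou
  filter_upwards [hZ₀] with ω hω using (Real.enorm_of_nonneg hω).symm

theorem integrable_intervalIntegral [SFinite P] {E : Type*} [NormedAddCommGroup E]
    [NormedSpace ℝ E] {F : ℝ → Ω → E} {a b : ℝ}
    (h : Integrable (Function.uncurry F) ((volume.restrict (Set.uIoc a b)).prod P)) :
    Integrable (fun ω => ∫ s in a..b, F s ω) P := by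
  simp only [intervalIntegral.intervalIntegral_eq_integral_uIoc]
  exact h.integral_prod_right.smul _

variable {ℱ : Filtration ℝ≥0 mΩ} {M : ℝ≥0 → Ω → ℝ}

theorem exists_martingale_eventually_eq_of_locally (h : Locally (fun M => Martingale M ℱ P) ℱ M P) :
    ∃ N : ℕ → ℝ≥0 → Ω → ℝ, (∀ k, Martingale (N k) ℱ P) ∧
      (∀ k t ω, N k t ω = 0 ∨ ∃ r ≤ t, N k t ω = M r ω) ∧
      ∀ᵐ ω ∂P, ∀ t, ∀ᶠ k in atTop, N k t ω = M t ω := by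
  obtain ⟨τ, hτ, hN⟩ := h
  refine ⟨_, hN, fun k t ω => ?_, ?_⟩
  · by_cases hω : ω ∈ {ω | ⊥ < τ k ω}
    · refine Or.inr ⟨_, WithTop.untopA_le (min_le_left (t : WithTop ℝ≥0) (τ k ω)), ?_⟩
      simp only [stoppedProcess, Set.indicator_of_mem hω]
    · exact Or.inl (by simp only [stoppedProcess, Set.indicator_of_notMem hω])
  · filter_upwards [hτ.tendsto_top] with ω hω t
    filter_upwards [hω.eventually_const_lt (WithTop.coe_lt_top t)] with k hk
    rw [stoppedProcess_eq_of_le hk.le, Set.indicator_of_mem]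
    exact bot_le.trans_lt hk

theorem integrable_and_integral_nonpos_of_locally [IsFiniteMeasure P]
    (h : Locally (fun M => Martingale M ℱ P) ℱ M P) (h₀ : ∀ᵐ ω ∂P, M 0 ω = 0) {K : ℝ}
    {t : ℝ≥0} (hK : ∀ r ≤ t, ∀ ω, -K ≤ M r ω) (hK₀ : 0 ≤ K) :
    Integrable (M t) P ∧ ∫ ω, M t ω ∂P ≤ 0 := by
  obtain ⟨N, hN, hNM, hlim⟩ := exists_martingale_eventually_eq_of_locally h
  have hmean : ∀ k, ∫ ω, N k t ω ∂P = 0 := fun k => by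
    have hconst := (hN k).setIntegral_eq (zero_le : (0 : ℝ≥0) ≤ t) MeasurableSet.univ
    rw [setIntegral_univ, setIntegral_univ] at hconst
    refine hconst.symm.trans (integral_eq_zero_of_ae ?_)
    filter_upwards [h₀] with ω hω
    rcases hNM k 0 ω with h | ⟨r, hr, h⟩
    · exact h
    · rw [h, nonpos_iff_eq_zero.1 hr, hω, Pi.zero_apply]
  have hadd : ∀ {X : Ω → ℝ}, Integrable X P →
      ∫ ω, (X ω + K) ∂P = ∫ ω, X ω ∂P + ∫ _, K ∂P := fun hX =>
    integral_add hX (integrable_const K)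
  have hlow : ∀ k ω, 0 ≤ N k t ω + K := fun k ω => by
    rcases hNM k t ω with h | ⟨r, hr, h⟩
    · rwa [h, zero_add]
    · linarith [hK r hr ω]
  obtain ⟨hint, hle⟩ := integrable_and_integral_le_of_tendsto (c := ∫ _, K ∂P)
    (fun k => ((hN k).integrable t).add (integrable_const K)) (fun k => ae_of_all _ (hlow k))
    (fun k => (hadd ((hN k).integrable t)).trans_le (by rw [hmean, zero_add]))
    (hlim.mono fun ω hω => (tendsto_nhds_of_eventually_eq (hω t)).add_const K)
  have hM : Integrable (M t) P := by simpa [Pi.sub_def] using hint.sub (integrable_const K)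
  exact ⟨hM, by rwa [hadd hM, add_le_iff_nonpos_left] at hle⟩

theorem setIntegral_eq_of_locally [SigmaFiniteFiltration P ℱ]
    (h : Locally (fun M => Martingale M ℱ P) ℱ M P) {s t : ℝ≥0} (hst : s ≤ t) {Z : Ω → ℝ}
    (hZ : Integrable Z P) (hMZ : ∀ r ≤ t, ∀ ω, |M r ω| ≤ Z ω) {A : Set Ω}
    (hA : MeasurableSet[ℱ s] A) :
    ∫ ω in A, M s ω ∂P = ∫ ω in A, M t ω ∂P := by
  obtain ⟨N, hN, hNM, hlim⟩ := exists_martingale_eventually_eq_of_locally h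
  have htendsto : ∀ u ≤ t, Tendsto (fun k => ∫ ω in A, N k u ω ∂P) atTop
      (𝓝 (∫ ω in A, M u ω ∂P)) := fun u hu => by
    refine tendsto_integral_of_dominated_convergence Z
      (fun k => ((hN k).integrable u).aestronglyMeasurable.restrict) hZ.restrict
      (fun k => ae_of_all _ fun ω => ?_)
      (ae_restrict_of_ae (hlim.mono fun ω hω => tendsto_nhds_of_eventually_eq (hω u)))
    rcases hNM k u ω with h | ⟨r, hr, h⟩
    · simpa only [h, norm_zero] using (abs_nonneg _).trans (hMZ u hu ω)
    · simpa only [h, Real.norm_eq_abs] using hMZ r (hr.trans hu) ω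
  exact tendsto_nhds_unique (htendsto s hst)
    ((htendsto t le_rfl).congr fun k => ((hN k).setIntegral_eq hst hA).symm)

end Integrals

/-! ### Moment bounds -/

namespace JumpDiffusionOperator

variable {𝒢 : JumpDiffusionOperator}

theorem IsPolynomial.apply_mul_damping_le (h : 𝒢.IsPolynomial) {v : ℝ → ℝ} {C c x : ℝ} {d : ℕ}
    (hv : HasC2Growth v C d) (hv₀ : ∀ x, 0 ≤ v x) (hc : 0 ≤ c) (hvx : 𝒢.apply v x ≤ c * v x)
    (m : ℕ) : 𝒢.apply (fun y => v y * damping v m y) x ≤ c * (v x * damping v m x) := by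
  have hu₀ := (damping_pos hv₀ m x).le
  calc 𝒢.apply (fun y => v y * damping v m y) x
      ≤ 𝒢.apply (fun y => damping v m x ^ 2 * v y) x :=
        h.apply_le_apply_of_sub_le (hv.mul (hasC2Growth_damping hv hv₀ m)) (hv.const_mul _)
          fun y => (mul_damping_sub_le hv₀ m x y).trans_eq (mul_sub _ _ _)
    _ = damping v m x ^ 2 * 𝒢.apply v x := 𝒢.apply_const_mul _ v x
    _ ≤ damping v m x ^ 2 * (c * v x) := by gcongr
    _ ≤ damping v m x * (c * v x) := by
        have := mul_nonneg hc (hv₀ x)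
        gcongr
        exact pow_le_of_le_one hu₀ (damping_le_one hv₀ m x) two_ne_zero
    _ = c * (v x * damping v m x) := by ring

theorem IsPolynomial.exists_apply_one_add_sq_pow_le (h : 𝒢.IsPolynomial) (k : ℕ) :
    ∃ c, 0 ≤ c ∧ ∀ x, 𝒢.apply (fun y => (1 + y ^ 2) ^ k) x ≤ c * (1 + x ^ 2) ^ k := by
  obtain ⟨q, hq, hqx⟩ := h.exists_apply_eval_eq ((1 + Polynomial.X ^ 2) ^ k)
  obtain ⟨c, hc, hle⟩ := exists_abs_eval_le q
  refine ⟨c, hc, fun x => ?_⟩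
  simp only [Polynomial.eval_pow, Polynomial.eval_add, Polynomial.eval_one,
    Polynomial.eval_X] at hqx
  rw [hqx]
  exact (le_abs_self _).trans (hle k (hq.trans (natDegree_one_add_X_sq_pow_le k)) x)

/-- The process `f(Y(t)) - f(y) - ∫₀ᵗ 𝒢 f(Y(s)) ds`, whose martingale property for polynomials `f`
is the content of the moment formula. -/
noncomputable def compensated {Ω : Type*} (𝒢 : JumpDiffusionOperator) (Y : ℝ≥0 → Ω → ℝ) (y : ℝ)
    (f : ℝ → ℝ) (t : ℝ≥0) (ω : Ω) : ℝ :=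
  f (Y t ω) - f y - ∫ s in (0 : ℝ)..t, 𝒢.apply f (Y s.toNNReal ω)

end JumpDiffusionOperator

namespace IsJumpDiffusion

open JumpDiffusionOperator

variable {Ω : Type*} {mΩ : MeasurableSpace Ω} {𝒢 : JumpDiffusionOperator} {P : Measure Ω}
  {ℱ : Filtration ℝ≥0 mΩ} {Y : ℝ≥0 → Ω → ℝ} {y : ℝ}

theorem measurable (hY : IsJumpDiffusion 𝒢 P ℱ Y y) (t : ℝ≥0) : Measurable (Y t) :=
  ((hY.stronglyAdapted t).mono (ℱ.le t)).measurable

theorem rightContinuous_toNNReal (hY : IsJumpDiffusion 𝒢 P ℱ Y y) (ω : Ω) (t : ℝ) :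
    ContinuousWithinAt (fun s : ℝ => Y s.toNNReal ω) (Set.Ici t) t :=
  (hY.right_continuous ω _).comp continuous_real_toNNReal.continuousWithinAt
    fun _ hs => Real.toNNReal_le_toNNReal hs

theorem measurable_uncurry (hY : IsJumpDiffusion 𝒢 P ℱ Y y) :
    Measurable fun q : ℝ × Ω => Y q.1.toNNReal q.2 :=
  measurable_uncurry_of_rightContinuous (X := fun s : ℝ => Y s.toNNReal)
    (fun _ => hY.measurable _) hY.rightContinuous_toNNReal

theorem exists_abs_le (hY : IsJumpDiffusion 𝒢 P ℱ Y y) (T : ℝ≥0) (ω : Ω) :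
    ∃ B, ∀ s ≤ T, |Y s ω| ≤ B := by
  obtain ⟨B, hB⟩ := exists_norm_le_of_rightContinuous_of_leftLimits (hY.right_continuous ω)
    (hY.left_limits ω) 0 T
  exact ⟨B, fun s hs => hB s ⟨zero_le, hs⟩⟩

theorem intervalIntegrable (hY : IsJumpDiffusion 𝒢 P ℱ Y y) {g : ℝ → ℝ} (hg : Measurable g)
    {K : ℝ} {N : ℕ} (hK : ∀ x, |g x| ≤ K * (1 + x ^ 2) ^ N) (a b : ℝ) (ω : Ω) :
    IntervalIntegrable (fun s : ℝ => g (Y s.toNNReal ω)) volume a b := by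
  obtain ⟨B, hB⟩ := hY.exists_abs_le (max a b).toNNReal ω
  have hK₀ : 0 ≤ K := by simpa using (abs_nonneg _).trans (hK 0)
  rw [intervalIntegrable_iff]
  refine Measure.integrableOn_of_bounded (M := K * (1 + B ^ 2) ^ N) (by simp)
    (hg.comp (hY.measurable_uncurry.comp measurable_prodMk_right)).aestronglyMeasurable ?_
  refine (ae_restrict_iff' measurableSet_uIoc).2 (ae_of_all _ fun s hs => (hK _).trans ?_)
  have : (Y s.toNNReal ω) ^ 2 ≤ B ^ 2 :=
    sq_le_sq.2 ((hB _ (Real.toNNReal_le_toNNReal hs.2)).trans (le_abs_self B))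
  gcongr

section Bounded

variable [IsFiniteMeasure P] {f : ℝ → ℝ} {B : ℝ}

theorem integrable_of_bounded (hY : IsJumpDiffusion 𝒢 P ℱ Y y) (hf : Measurable f)
    (hB : ∀ x, |f x| ≤ B) (t : ℝ≥0) : Integrable (fun ω => f (Y t ω)) P :=
  Integrable.of_bound (hf.comp (hY.measurable t)).aestronglyMeasurable B
    (ae_of_all _ fun _ => hB _)

theorem integrable_prod_of_bounded (hY : IsJumpDiffusion 𝒢 P ℱ Y y) (hf : Measurable f)
    (hB : ∀ x, |f x| ≤ B) (a b : ℝ) :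
    Integrable (Function.uncurry fun (s : ℝ) ω => f (Y s.toNNReal ω))
      ((volume.restrict (Set.uIoc a b)).prod P) := by
  have : IsFiniteMeasure (volume.restrict (Set.uIoc a b)) := ⟨by simp [Set.uIoc]⟩
  exact Integrable.of_bound (hf.comp hY.measurable_uncurry).aestronglyMeasurable B
    (ae_of_all _ fun _ => hB _)

theorem rightContinuous_integral_of_bounded (hY : IsJumpDiffusion 𝒢 P ℱ Y y) (hf : Continuous f)
    (hB : ∀ x, |f x| ≤ B) (t : ℝ) :
    ContinuousWithinAt (fun s : ℝ => ∫ ω, f (Y s.toNNReal ω) ∂P) (Set.Ici t) t :=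
  continuousWithinAt_of_dominated
    (Eventually.of_forall fun _ => (hf.measurable.comp (hY.measurable _)).aestronglyMeasurable)
    (Eventually.of_forall fun _ => ae_of_all _ fun _ => hB _) (integrable_const B)
    (ae_of_all _ fun ω => hf.continuousAt.comp_continuousWithinAt (hY.rightContinuous_toNNReal ω t))

end Bounded

section Supersolution

variable {f : ℝ → ℝ} {C B c : ℝ} {d : ℕ}

theorem le_compensated_add (hY : IsJumpDiffusion 𝒢 P ℱ Y y) (h𝒢 : 𝒢.IsPolynomial)
    (hf : HasC2Growth f C d) (hfc : ∀ x, 𝒢.apply f x ≤ c * f x) (t : ℝ≥0) (ω : Ω) :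
    f (Y t ω) ≤ compensated 𝒢 Y y f t ω
      + (f y + c * ∫ s in (0 : ℝ)..t, f (Y s.toNNReal ω)) := by
  obtain ⟨K, N, -, hK⟩ := h𝒢.exists_abs_apply_le d
  have hle : ∫ s in (0 : ℝ)..t, 𝒢.apply f (Y s.toNNReal ω)
      ≤ c * ∫ s in (0 : ℝ)..t, f (Y s.toNNReal ω) := by
    rw [← intervalIntegral.integral_const_mul]
    exact intervalIntegral.integral_mono_on t.2
      (hY.intervalIntegrable (h𝒢.measurable_apply hf) (hK f C hf) _ _ _)
      ((hY.intervalIntegrable hf.contDiff.continuous.measurable hf.abs_le _ _ _).const_mul c)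
      fun s _ => hfc _
  rw [compensated]
  linarith

theorem neg_le_compensated (hY : IsJumpDiffusion 𝒢 P ℱ Y y) (h𝒢 : 𝒢.IsPolynomial)
    (hf : HasC2Growth f C d) (hf₀ : ∀ x, 0 ≤ f x) (hB : ∀ x, f x ≤ B) (hc : 0 ≤ c)
    (hfc : ∀ x, 𝒢.apply f x ≤ c * f x) {r t : ℝ≥0} (hrt : r ≤ t) (ω : Ω) :
    -(B + c * (B * t)) ≤ compensated 𝒢 Y y f r ω := by
  have hB₀ : 0 ≤ B := (hf₀ 0).trans (hB 0)
  have hint : ∫ s in (0 : ℝ)..r, f (Y s.toNNReal ω) ≤ B * t :=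
    calc ∫ s in (0 : ℝ)..r, f (Y s.toNNReal ω) ≤ ∫ _ in (0 : ℝ)..r, B :=
          intervalIntegral.integral_mono_on r.2
            (hY.intervalIntegrable hf.contDiff.continuous.measurable hf.abs_le _ _ _)
            intervalIntegrable_const fun s _ => hB _
      _ = B * r := by simp [mul_comm]
      _ ≤ B * t := by gcongr
  have := hY.le_compensated_add h𝒢 hf hfc r ω
  have := mul_le_mul_of_nonneg_left hint hc
  linarith [hf₀ (Y r ω), hB y]

variable [IsProbabilityMeasure P]

theorem integral_le_add_integral (hY : IsJumpDiffusion 𝒢 P ℱ Y y) (h𝒢 : 𝒢.IsPolynomial)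
    (hf : HasC2Growth f C d) (hf₀ : ∀ x, 0 ≤ f x) (hB : ∀ x, f x ≤ B) (hc : 0 ≤ c)
    (hfc : ∀ x, 𝒢.apply f x ≤ c * f x) (t : ℝ≥0) :
    ∫ ω, f (Y t ω) ∂P ≤ f y + c * ∫ s in (0 : ℝ)..t, ∫ ω, f (Y s.toNNReal ω) ∂P := by
  have hB₀ : 0 ≤ B := (hf₀ 0).trans (hB 0)
  have habs : ∀ x, |f x| ≤ B := fun x => (abs_of_nonneg (hf₀ x)).trans_le (hB x)
  have hfm : Measurable f := hf.contDiff.continuous.measurable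
  obtain ⟨hint, hle⟩ : Integrable (compensated 𝒢 Y y f t) P ∧
      ∫ ω, compensated 𝒢 Y y f t ω ∂P ≤ 0 := integrable_and_integral_nonpos_of_locally
    (hY.local_martingale f hf.contDiff ⟨B, habs⟩)
    (by filter_upwards [hY.initial] with ω hω using by simp [hω])
    (fun r hr => hY.neg_le_compensated h𝒢 hf hf₀ hB hc hfc hr) (by positivity)
  have hprod := hY.integrable_prod_of_bounded hfm habs 0 t
  have hintegral := (integrable_intervalIntegral hprod).const_mul c
  have hdrift : Integrable (fun ω => f y + c * ∫ s in (0 : ℝ)..t, f (Y s.toNNReal ω)) P :=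
    (integrable_const _).add hintegral
  calc ∫ ω, f (Y t ω) ∂P
      ≤ ∫ ω, (compensated 𝒢 Y y f t ω + (f y + c * ∫ s in (0 : ℝ)..t, f (Y s.toNNReal ω))) ∂P :=
        integral_mono (hY.integrable_of_bounded hfm habs t) (hint.add hdrift)
          (hY.le_compensated_add h𝒢 hf hfc t)
    _ = ∫ ω, compensated 𝒢 Y y f t ω ∂P
          + (f y + c * ∫ ω, (∫ s in (0 : ℝ)..t, f (Y s.toNNReal ω)) ∂P) := by
        rw [integral_add hint hdrift, integral_add (integrable_const _) hintegral,
          integral_const_mul, integral_const, probReal_univ, one_smul]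
    _ ≤ f y + c * ∫ s in (0 : ℝ)..t, ∫ ω, f (Y s.toNNReal ω) ∂P := by
        rw [intervalIntegral_integral_swap hprod]
        exact add_le_of_nonpos_left hle

theorem integral_le_mul_exp (hY : IsJumpDiffusion 𝒢 P ℱ Y y) (h𝒢 : 𝒢.IsPolynomial)
    (hf : HasC2Growth f C d) (hf₀ : ∀ x, 0 ≤ f x) (hB : ∀ x, f x ≤ B) (hc : 0 ≤ c)
    (hfc : ∀ x, 𝒢.apply f x ≤ c * f x) (t : ℝ≥0) :
    ∫ ω, f (Y t ω) ∂P ≤ f y * Real.exp (c * t) := by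
  have habs : ∀ x, |f x| ≤ B := fun x => (abs_of_nonneg (hf₀ x)).trans_le (hB x)
  have hfcont := hf.contDiff.continuous
  have hint : IntervalIntegrable (fun s : ℝ => ∫ ω, f (Y s.toNNReal ω) ∂P) volume 0 t :=
    intervalIntegrable_iff.2
      (hY.integrable_prod_of_bounded hfcont.measurable habs 0 t).integral_prod_left
  have hgronwall := le_mul_exp_of_le_add_integral t.2 hc
    (fun r _ => hY.rightContinuous_integral_of_bounded hfcont habs r) hint
    fun r hr => by
      simpa only [Real.coe_toNNReal r hr.1] using
        hY.integral_le_add_integral h𝒢 hf hf₀ hB hc hfc r.toNNReal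
  simpa using hgronwall

theorem exists_moment_le (hY : IsJumpDiffusion 𝒢 P ℱ Y y) (h𝒢 : 𝒢.IsPolynomial) (k : ℕ) :
    ∃ c, 0 ≤ c ∧ ∀ t : ℝ≥0, Integrable (fun ω => (1 + Y t ω ^ 2) ^ k) P ∧
      ∫ ω, (1 + Y t ω ^ 2) ^ k ∂P ≤ (1 + y ^ 2) ^ k * Real.exp (c * t) := by
  set v : ℝ → ℝ := fun x => (1 + x ^ 2) ^ k
  have hv₀ : ∀ x, 0 ≤ v x := fun x => by positivity
  obtain ⟨C, hv⟩ := exists_hasC2Growth_one_add_sq_pow k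
  obtain ⟨c, hc, hvc⟩ := h𝒢.exists_apply_one_add_sq_pow_le k
  have hf := fun m => hv.mul (hasC2Growth_damping hv hv₀ m)
  have hf₀ : ∀ m x, 0 ≤ v x * damping v m x := fun m x =>
    mul_nonneg (hv₀ x) (damping_pos hv₀ m x).le
  refine ⟨c, hc, fun t => integrable_and_integral_le_of_tendsto
    (X := fun m ω => v (Y t ω) * damping v m (Y t ω)) (fun m => ?_)
    (fun m => ae_of_all _ fun ω => hf₀ m _) (fun m => ?_) (ae_of_all _ fun ω => ?_)⟩
  · exact hY.integrable_of_bounded (f := fun x => v x * damping v m x)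
      (hf m).contDiff.continuous.measurable
      (fun x => (abs_of_nonneg (hf₀ m x)).trans_le (mul_damping_le hv₀ m x)) t
  · refine (hY.integral_le_mul_exp h𝒢 (hf m) (hf₀ m) (mul_damping_le hv₀ m) hc
      (fun x => h𝒢.apply_mul_damping_le hv hv₀ hc (hvc x) m) t).trans ?_
    gcongr
    exact mul_le_of_le_one_right (hv₀ y) (damping_le_one hv₀ m y)
  · simpa using (tendsto_damping v (Y t ω)).const_mul (v (Y t ω))

end Supersolution

/-! ### Dynkin's formula -/

section Growth

variable [IsProbabilityMeasure P] {g : ℝ → ℝ} {K : ℝ} {N : ℕ}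

theorem integrable_of_growth (hY : IsJumpDiffusion 𝒢 P ℱ Y y) (h𝒢 : 𝒢.IsPolynomial)
    (hg : Measurable g) (hK : ∀ x, |g x| ≤ K * (1 + x ^ 2) ^ N) (t : ℝ≥0) :
    Integrable (fun ω => g (Y t ω)) P := by
  obtain ⟨c, -, h⟩ := hY.exists_moment_le h𝒢 N
  exact ((h t).1.const_mul K).mono' (hg.comp (hY.measurable t)).aestronglyMeasurable
    (ae_of_all _ fun ω => hK _)

theorem integrable_eval (hY : IsJumpDiffusion 𝒢 P ℱ Y y) (h𝒢 : 𝒢.IsPolynomial)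
    (p : Polynomial ℝ) (t : ℝ≥0) : Integrable (fun ω => p.eval (Y t ω)) P := by
  obtain ⟨C, -, hC⟩ := exists_abs_eval_le p
  exact hY.integrable_of_growth h𝒢 p.continuous.measurable (hC p.natDegree (by omega)) t

theorem integrable_prod_one_add_sq_pow (hY : IsJumpDiffusion 𝒢 P ℱ Y y) (h𝒢 : 𝒢.IsPolynomial)
    (N : ℕ) (a b : ℝ) :
    Integrable (Function.uncurry fun (s : ℝ) ω => (1 + Y s.toNNReal ω ^ 2) ^ N)
      ((volume.restrict (Set.uIoc a b)).prod P) := by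
  have : IsFiniteMeasure (volume.restrict (Set.uIoc a b)) := ⟨by simp [Set.uIoc]⟩
  obtain ⟨c, hc, h⟩ := hY.exists_moment_le h𝒢 N
  have hm : Measurable (Function.uncurry fun (s : ℝ) ω => (1 + Y s.toNNReal ω ^ 2) ^ N) :=
    ((hY.measurable_uncurry.pow_const 2).const_add 1).pow_const N
  refine (integrable_prod_iff hm.aestronglyMeasurable).2
    ⟨ae_of_all _ fun s => (h s.toNNReal).1, ?_⟩
  refine Integrable.of_bound hm.norm.stronglyMeasurable.integral_prod_right'.aestronglyMeasurable
    ((1 + y ^ 2) ^ N * Real.exp (c * (max a b).toNNReal)) ?_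
  refine (ae_restrict_iff' measurableSet_uIoc).2 (ae_of_all _ fun s hs => ?_)
  have hnorm : ∀ ω, ‖(1 + Y s.toNNReal ω ^ 2) ^ N‖ = (1 + Y s.toNNReal ω ^ 2) ^ N := fun ω =>
    Real.norm_of_nonneg (by positivity)
  simp only [Function.uncurry_apply_pair, hnorm]
  rw [Real.norm_of_nonneg (integral_nonneg fun _ => by positivity)]
  refine (h s.toNNReal).2.trans ?_
  gcongr
  exact hs.2

theorem integrable_prod_of_growth (hY : IsJumpDiffusion 𝒢 P ℱ Y y) (h𝒢 : 𝒢.IsPolynomial)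
    (hg : Measurable g) (hK : ∀ x, |g x| ≤ K * (1 + x ^ 2) ^ N) (a b : ℝ) (A : Set Ω) :
    Integrable (Function.uncurry fun (s : ℝ) ω => g (Y s.toNNReal ω))
      ((volume.restrict (Set.uIoc a b)).prod (P.restrict A)) := by
  have hprod := ((hY.integrable_prod_one_add_sq_pow h𝒢 N a b).const_mul K).mono'
    (hg.comp hY.measurable_uncurry).aestronglyMeasurable (ae_of_all _ fun q => hK _)
  have hrestrict := hprod.integrableOn (s := Set.univ ×ˢ A)
  rwa [IntegrableOn, ← Measure.prod_restrict, Measure.restrict_univ] at hrestrict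

end Growth

theorem abs_compensated_le (hY : IsJumpDiffusion 𝒢 P ℱ Y y) {f : ℝ → ℝ} {K : ℝ} {N : ℕ}
    (hK : ∀ x, |𝒢.apply f x| ≤ K * (1 + x ^ 2) ^ N) {r t : ℝ≥0} (hrt : r ≤ t) (ω : Ω) :
    |compensated 𝒢 Y y f r ω| ≤ |f (Y r ω)| + |f y|
      + K * ∫ s in (0 : ℝ)..t, (1 + Y s.toNNReal ω ^ 2) ^ N := by
  have hK₀ : 0 ≤ K := by simpa using (abs_nonneg _).trans (hK 0)
  have hi : ∀ a b, IntervalIntegrable (fun s : ℝ => K * (1 + Y s.toNNReal ω ^ 2) ^ N)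
      volume a b := fun a b =>
    hY.intervalIntegrable (g := fun x => K * (1 + x ^ 2) ^ N) (by fun_prop)
      (fun x => (abs_of_nonneg (by positivity)).le) a b ω
  have hdrift : |∫ s in (0 : ℝ)..r, 𝒢.apply f (Y s.toNNReal ω)|
      ≤ K * ∫ s in (0 : ℝ)..t, (1 + Y s.toNNReal ω ^ 2) ^ N :=
    calc ‖∫ s in (0 : ℝ)..r, 𝒢.apply f (Y s.toNNReal ω)‖
        ≤ ∫ s in (0 : ℝ)..r, K * (1 + Y s.toNNReal ω ^ 2) ^ N :=
          intervalIntegral.norm_integral_le_of_norm_le r.2 (ae_of_all _ fun s _ => hK _) (hi _ _)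
      _ ≤ ∫ s in (0 : ℝ)..t, K * (1 + Y s.toNNReal ω ^ 2) ^ N :=
          intervalIntegral.integral_mono_interval le_rfl r.2 (NNReal.coe_le_coe.2 hrt)
            (ae_of_all _ fun s => by positivity) (hi _ _)
      _ = _ := intervalIntegral.integral_const_mul _ _
  exact (abs_sub _ _).trans (add_le_add (abs_sub _ _) hdrift)

section Dynkin

variable [IsProbabilityMeasure P] {f : ℝ → ℝ} {C : ℝ} {d : ℕ}

theorem integrable_integral_one_add_sq_pow (hY : IsJumpDiffusion 𝒢 P ℱ Y y)
    (h𝒢 : 𝒢.IsPolynomial) (N : ℕ) (a b : ℝ) :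
    Integrable (fun ω => ∫ s in a..b, (1 + Y s.toNNReal ω ^ 2) ^ N) P :=
  integrable_intervalIntegral (hY.integrable_prod_one_add_sq_pow h𝒢 N a b)

theorem setIntegral_compensated_eq_sub (hY : IsJumpDiffusion 𝒢 P ℱ Y y) (h𝒢 : 𝒢.IsPolynomial)
    (hf : HasC2Growth f C d) (t : ℝ≥0) (A : Set Ω) :
    ∫ ω in A, compensated 𝒢 Y y f t ω ∂P = ∫ ω in A, f (Y t ω) ∂P - ∫ _ in A, f y ∂P
      - ∫ r in (0 : ℝ)..t, ∫ ω in A, 𝒢.apply f (Y r.toNNReal ω) ∂P := by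
  obtain ⟨K, N, -, hK⟩ := h𝒢.exists_abs_apply_le d
  have hprod := hY.integrable_prod_of_growth h𝒢 (h𝒢.measurable_apply hf) (hK f C hf) 0 t A
  have hft := (hY.integrable_of_growth h𝒢 hf.contDiff.continuous.measurable hf.abs_le t).restrict
    (s := A)
  have hsub : Integrable (fun ω => f (Y t ω) - f y) (P.restrict A) := hft.sub (integrable_const _)
  rw [intervalIntegral_integral_swap hprod, ← integral_sub hft (integrable_const _),
    ← integral_sub hsub (integrable_intervalIntegral hprod)]
  rfl

theorem aestronglyMeasurable_compensated (hY : IsJumpDiffusion 𝒢 P ℱ Y y) (h𝒢 : 𝒢.IsPolynomial)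
    (hf : HasC2Growth f C d) (t : ℝ≥0) : AEStronglyMeasurable (compensated 𝒢 Y y f t) P := by
  obtain ⟨K, N, -, hK⟩ := h𝒢.exists_abs_apply_le d
  have hprod := hY.integrable_prod_of_growth h𝒢 (h𝒢.measurable_apply hf) (hK f C hf) 0 t Set.univ
  rw [Measure.restrict_univ] at hprod
  exact ((hf.contDiff.continuous.measurable.comp
    (hY.measurable t)).sub_const (f y)).aestronglyMeasurable.sub
    (integrable_intervalIntegral hprod).aestronglyMeasurable

theorem setIntegral_compensated_eq_of_le_of_bounded (hY : IsJumpDiffusion 𝒢 P ℱ Y y)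
    (h𝒢 : 𝒢.IsPolynomial) (hf : HasC2Growth f C d) {B : ℝ} (hB : ∀ x, |f x| ≤ B) {s t : ℝ≥0}
    (hst : s ≤ t) {A : Set Ω} (hA : MeasurableSet[ℱ s] A) :
    ∫ ω in A, compensated 𝒢 Y y f s ω ∂P = ∫ ω in A, compensated 𝒢 Y y f t ω ∂P := by
  obtain ⟨K, N, -, hK⟩ := h𝒢.exists_abs_apply_le d
  refine setIntegral_eq_of_locally (hY.local_martingale f hf.contDiff ⟨B, hB⟩) hst
    ((integrable_const (B + B)).add
      ((hY.integrable_integral_one_add_sq_pow h𝒢 N 0 t).const_mul (C * K)))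
    (fun r hr ω => (hY.abs_compensated_le (hK f C hf) hr ω).trans ?_) hA
  exact add_le_add_left (add_le_add (hB _) (hB _)) _

theorem tendsto_setIntegral_compensated (hY : IsJumpDiffusion 𝒢 P ℱ Y y) (h𝒢 : 𝒢.IsPolynomial)
    {F : ℕ → ℝ → ℝ} (hF : ∀ m, HasC2Growth (F m) C d)
    (h₀ : ∀ x, Tendsto (fun m => F m x) atTop (𝓝 (f x)))
    (h𝒢F : ∀ x, Tendsto (fun m => 𝒢.apply (F m) x) atTop (𝓝 (𝒢.apply f x))) (t : ℝ≥0)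
    (A : Set Ω) :
    Tendsto (fun m => ∫ ω in A, compensated 𝒢 Y y (F m) t ω ∂P) atTop
      (𝓝 (∫ ω in A, compensated 𝒢 Y y f t ω ∂P)) := by
  obtain ⟨K, N, hK₀, hK⟩ := h𝒢.exists_abs_apply_le d
  have hCK : 0 ≤ C * K := mul_nonneg (hF 0).nonneg hK₀
  have hmoment : Integrable (fun ω => C * (1 + Y t ω ^ 2) ^ d) P := by
    obtain ⟨c, -, hc⟩ := hY.exists_moment_le h𝒢 d
    exact (hc t).1.const_mul C
  refine tendsto_integral_of_dominated_convergence
    (fun ω => C * (1 + Y t ω ^ 2) ^ d + C * (1 + y ^ 2) ^ d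
      + C * K * ∫ s in (0 : ℝ)..t, (1 + Y s.toNNReal ω ^ 2) ^ N)
    (fun m => (hY.aestronglyMeasurable_compensated h𝒢 (hF m) t).restrict)
    ((hmoment.add (integrable_const _)).add
      ((hY.integrable_integral_one_add_sq_pow h𝒢 N 0 t).const_mul _)).restrict
    (fun m => ae_of_all _ fun ω => ?_) (ae_of_all _ fun ω => ?_)
  · exact (hY.abs_compensated_le (hK _ C (hF m)) le_rfl ω).trans
      (add_le_add_left (add_le_add ((hF m).abs_le _) ((hF m).abs_le _)) _)
  · refine ((h₀ _).sub (h₀ _)).sub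
      (intervalIntegral.tendsto_integral_filter_of_dominated_convergence
        (fun s => C * K * (1 + Y s.toNNReal ω ^ 2) ^ N) (Eventually.of_forall fun m => ?_)
        (Eventually.of_forall fun m => ae_of_all _ fun s _ => hK _ C (hF m) _) ?_
        (ae_of_all _ fun s _ => h𝒢F _))
    · exact ((h𝒢.measurable_apply (hF m)).comp
        (hY.measurable_uncurry.comp measurable_prodMk_right)).aestronglyMeasurable
    · exact hY.intervalIntegrable (g := fun x => C * K * (1 + x ^ 2) ^ N) (by fun_prop)
        (fun x => (abs_of_nonneg (by positivity)).le) _ _ ω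

theorem setIntegral_compensated_eq_of_le (hY : IsJumpDiffusion 𝒢 P ℱ Y y) (h𝒢 : 𝒢.IsPolynomial)
    (hf : HasC2Growth f C d) {s t : ℝ≥0} (hst : s ≤ t) {A : Set Ω}
    (hA : MeasurableSet[ℱ s] A) :
    ∫ ω in A, compensated 𝒢 Y y f s ω ∂P = ∫ ω in A, compensated 𝒢 Y y f t ω ∂P := by
  set v : ℝ → ℝ := fun x => (1 + x ^ 2) ^ d
  have hv₀ : ∀ x, 0 ≤ v x := fun x => by positivity
  obtain ⟨C', hv⟩ := exists_hasC2Growth_one_add_sq_pow d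
  have hF := fun m => hf.mul (hasC2Growth_damping hv hv₀ m)
  have hF₀ : ∀ x, Tendsto (fun m => f x * damping v m x) atTop (𝓝 (f x)) := fun x => by
    simpa using (tendsto_damping v x).const_mul (f x)
  have hlim := hY.tendsto_setIntegral_compensated h𝒢 hF hF₀ fun x => h𝒢.tendsto_apply hF hF₀
    (tendsto_deriv_mul_damping hv hv₀ hf x) (tendsto_deriv_deriv_mul_damping hv hv₀ hf x)
  have hB : ∀ (m : ℕ) x, |f x * damping v m x| ≤ C * (m + 1) := fun m x =>
    calc |f x * damping v m x| = |f x| * damping v m x := by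
          rw [abs_mul, abs_of_pos (damping_pos hv₀ m x)]
      _ ≤ C * v x * damping v m x :=
          mul_le_mul_of_nonneg_right (hf.abs_le x) (damping_pos hv₀ m x).le
      _ ≤ C * (m + 1) := by
          rw [mul_assoc]
          exact mul_le_mul_of_nonneg_left (mul_damping_le hv₀ m x) hf.nonneg
  exact tendsto_nhds_unique (hlim s A) ((hlim t A).congr fun m =>
    (hY.setIntegral_compensated_eq_of_le_of_bounded h𝒢 (hF m) (hB m) hst hA).symm)

theorem setIntegral_eq_add_integral_apply (hY : IsJumpDiffusion 𝒢 P ℱ Y y)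
    (h𝒢 : 𝒢.IsPolynomial) (hf : HasC2Growth f C d) {s t : ℝ≥0} (hst : s ≤ t) {A : Set Ω}
    (hA : MeasurableSet[ℱ s] A) :
    ∫ ω in A, f (Y t ω) ∂P = ∫ ω in A, f (Y s ω) ∂P
      + ∫ r in (s : ℝ)..t, ∫ ω in A, 𝒢.apply f (Y r.toNNReal ω) ∂P := by
  obtain ⟨K, N, -, hK⟩ := h𝒢.exists_abs_apply_le d
  have hi : ∀ a b : ℝ, IntervalIntegrable
      (fun r => ∫ ω in A, 𝒢.apply f (Y r.toNNReal ω) ∂P) volume a b := fun a b =>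
    intervalIntegrable_iff.2 (hY.integrable_prod_of_growth h𝒢 (h𝒢.measurable_apply hf)
      (hK f C hf) a b A).integral_prod_left
  have hcongr := hY.setIntegral_compensated_eq_of_le h𝒢 hf hst hA
  rw [hY.setIntegral_compensated_eq_sub h𝒢 hf, hY.setIntegral_compensated_eq_sub h𝒢 hf] at hcongr
  have hadd := intervalIntegral.integral_add_adjacent_intervals (hi 0 s) (hi s t)
  linarith

end Dynkin

end IsJumpDiffusion

/-! ### The moment formula -/

section LinearODE

variable {ι : Type*} [Fintype ι] [DecidableEq ι]

open scoped Matrix.Norms.Operator in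
theorem hasDerivAt_exp_smul_mulVec (G : Matrix ι ι ℝ) (v : ι → ℝ) (s r : ℝ) :
    HasDerivAt (fun r : ℝ => NormedSpace.exp ((r - s) • G) *ᵥ v)
      (G *ᵥ (NormedSpace.exp ((r - s) • G) *ᵥ v)) r := by
  rw [Matrix.mulVec_mulVec]
  exact ((Matrix.mulVecBilin ℝ ℝ).flip v).toContinuousLinearMap.hasFDerivAt.comp_hasDerivAt r
    ((hasDerivAt_exp_smul_const' (𝕂 := ℝ) G (r - s)).comp_sub_const r s)

theorem eq_exp_smul_mulVec_of_eq_add_integral (G : Matrix ι ι ℝ) {μ : ℝ → ι → ℝ} {s t : ℝ}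
    (hst : s ≤ t) (hi : IntervalIntegrable (fun x => G *ᵥ μ x) volume s t)
    (hμ : ∀ r ∈ Set.Icc s t, μ r = μ s + ∫ x in s..r, G *ᵥ μ x) :
    μ t = NormedSpace.exp ((t - s) • G) *ᵥ μ s := by
  have hcont : ContinuousOn μ (Set.Icc s t) := by
    refine ContinuousOn.congr (Set.uIcc_of_le hst ▸ ?_) hμ
    exact (intervalIntegral.continuousOn_primitive_interval' hi Set.left_mem_uIcc).const_add _
  have hderiv : ∀ r ∈ Set.Ico s t, HasDerivWithinAt μ (G *ᵥ μ r) (Set.Ici r) r := by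
    intro r hr
    have hr' := Set.Ico_subset_Icc_self hr
    have hnhds : Set.Icc s t ∈ 𝓝[≥] r :=
      mem_of_superset (Icc_mem_nhdsGE hr.2) (Set.Icc_subset_Icc_left hr.1)
    refine ((hasDerivWithinAt_integral_of_rightContinuous hi hr ?_).const_add
      (μ s)).congr_of_eventuallyEq (eventually_of_mem hnhds hμ) (hμ r hr')
    exact (G.mulVecLin.toContinuousLinearMap.continuous.continuousAt).comp_continuousWithinAt
      ((hcont r hr').mono_of_mem_nhdsWithin hnhds)
  have hexp := hasDerivAt_exp_smul_mulVec G (μ s) s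
  exact ODE_solution_unique_of_mem_Icc_right (v := fun _ x => G *ᵥ x) (s := fun _ => Set.univ)
    (fun _ _ => G.mulVecLin.toContinuousLinearMap.lipschitz.lipschitzOnWith) hcont hderiv
    (fun _ _ => Set.mem_univ _) (fun r _ => (hexp r).continuousAt.continuousWithinAt)
    (fun r _ => (hexp r).hasDerivWithinAt) (fun _ _ => Set.mem_univ _) (by simp) ⟨hst, le_rfl⟩

end LinearODE

theorem coeffVec_dotProduct_monomialVec {n : ℕ} {p : Polynomial ℝ}
    (hp : p ∈ Polynomial.degreeLE ℝ n) (x : ℝ) :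
    coeffVec n p ⬝ᵥ monomialVec n x = p.eval x := by
  have hp : p.natDegree < n + 1 := Nat.lt_succ_iff.2
    (Polynomial.natDegree_le_of_degree_le (Polynomial.mem_degreeLE.1 hp))
  rw [Polynomial.eval_eq_sum_range' hp, ← Fin.sum_univ_eq_sum_range fun j => p.coeff j * x ^ j]
  rfl

theorem continuous_monomialVec (n : ℕ) : Continuous (monomialVec n) :=
  continuous_pi fun i => continuous_pow i

namespace IsJumpDiffusion

open JumpDiffusionOperator

variable {Ω : Type*} {mΩ : MeasurableSpace Ω} {𝒢 : JumpDiffusionOperator} {P : Measure Ω}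
  {ℱ : Filtration ℝ≥0 mΩ} {Y : ℝ≥0 → Ω → ℝ} {y : ℝ} [IsProbabilityMeasure P]

theorem integrable_monomialVec (hY : IsJumpDiffusion 𝒢 P ℱ Y y) (h𝒢 : 𝒢.IsPolynomial) (n : ℕ)
    (t : ℝ≥0) : Integrable (fun ω => monomialVec n (Y t ω)) P :=
  Integrable.of_eval fun i => by
    simpa [monomialVec] using hY.integrable_eval h𝒢 (Polynomial.X ^ (i : ℕ)) t

theorem setIntegral_apply_pow (hY : IsJumpDiffusion 𝒢 P ℱ Y y) (h𝒢 : 𝒢.IsPolynomial) {n : ℕ}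
    (i : Fin (n + 1)) (t : ℝ≥0) (A : Set Ω) :
    ∫ ω in A, 𝒢.apply (fun u => u ^ (i : ℕ)) (Y t ω) ∂P
      = (generatorMatrix h𝒢 n *ᵥ ∫ ω in A, monomialVec n (Y t ω) ∂P) i := by
  have hG : ∀ x, 𝒢.apply (fun u => u ^ (i : ℕ)) x = (generatorMatrix h𝒢 n *ᵥ monomialVec n x) i :=
    fun x => congrFun (generatorMatrix_mulVec h𝒢 n x) i
  simp only [hG]
  exact ((ContinuousLinearMap.proj i).comp
    (generatorMatrix h𝒢 n).mulVecLin.toContinuousLinearMap).integral_comp_comm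
    (hY.integrable_monomialVec h𝒢 n t).restrict

theorem intervalIntegrable_mulVec_setIntegral_monomialVec (hY : IsJumpDiffusion 𝒢 P ℱ Y y)
    (h𝒢 : 𝒢.IsPolynomial) (n : ℕ) (A : Set Ω) (a b : ℝ) :
    IntervalIntegrable (fun r : ℝ =>
      generatorMatrix h𝒢 n *ᵥ ∫ ω in A, monomialVec n (Y r.toNNReal ω) ∂P) volume a b := by
  have hprod : Integrable (Function.uncurry fun (r : ℝ) ω => monomialVec n (Y r.toNNReal ω))
      ((volume.restrict (Set.uIoc a b)).prod (P.restrict A)) := Integrable.of_eval fun i => by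
    obtain ⟨C, hC⟩ := exists_hasC2Growth_pow i
    exact hY.integrable_prod_of_growth h𝒢 (measurable_id.pow_const (i : ℕ)) hC.abs_le a b A
  exact intervalIntegrable_iff.2 <|
    (generatorMatrix h𝒢 n).mulVecLin.toContinuousLinearMap.integrable_comp hprod.integral_prod_left

theorem setIntegral_monomialVec_eq_add_integral (hY : IsJumpDiffusion 𝒢 P ℱ Y y)
    (h𝒢 : 𝒢.IsPolynomial) (n : ℕ) {s t : ℝ≥0} (hst : s ≤ t) {A : Set Ω}
    (hA : MeasurableSet[ℱ s] A) :
    ∫ ω in A, monomialVec n (Y t ω) ∂P = ∫ ω in A, monomialVec n (Y s ω) ∂P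
      + ∫ r in (s : ℝ)..t, generatorMatrix h𝒢 n *ᵥ ∫ ω in A, monomialVec n (Y r.toNNReal ω) ∂P := by
  ext i
  obtain ⟨C, hC⟩ := exists_hasC2Growth_pow i
  have hdynkin := hY.setIntegral_eq_add_integral_apply h𝒢 hC hst hA
  have heval : ∀ u, (∫ ω in A, monomialVec n (Y u ω) ∂P) i = ∫ ω in A, Y u ω ^ (i : ℕ) ∂P :=
    fun u => eval_integral (fun j => (hY.integrable_monomialVec h𝒢 n u).restrict.eval j) i
  have hdrift := (ContinuousLinearMap.proj (R := ℝ) (φ := fun _ : Fin (n + 1) => ℝ)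
    i).intervalIntegral_comp_comm
    (hY.intervalIntegrable_mulVec_setIntegral_monomialVec h𝒢 n A s t)
  simp only [hY.setIntegral_apply_pow h𝒢] at hdynkin
  rw [Pi.add_apply, heval, heval, hdynkin]
  exact congrArg _ hdrift

theorem setIntegral_monomialVec_eq_exp_mulVec (hY : IsJumpDiffusion 𝒢 P ℱ Y y)
    (h𝒢 : 𝒢.IsPolynomial) (n : ℕ) {s t : ℝ≥0} (hst : s ≤ t) {A : Set Ω}
    (hA : MeasurableSet[ℱ s] A) :
    ∫ ω in A, monomialVec n (Y t ω) ∂P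
      = NormedSpace.exp (((t : ℝ) - s) • generatorMatrix h𝒢 n)
        *ᵥ ∫ ω in A, monomialVec n (Y s ω) ∂P := by
  have hexp := eq_exp_smul_mulVec_of_eq_add_integral (generatorMatrix h𝒢 n)
    (NNReal.coe_le_coe.2 hst)
    (hY.intervalIntegrable_mulVec_setIntegral_monomialVec h𝒢 n A s t) fun r hr => by
      lift r to ℝ≥0 using s.2.trans hr.1
      simpa only [Real.toNNReal_coe] using
        hY.setIntegral_monomialVec_eq_add_integral h𝒢 n (NNReal.coe_le_coe.1 hr.1) hA
  simpa only [Real.toNNReal_coe] using hexp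

theorem condExp_monomialVec (hY : IsJumpDiffusion 𝒢 P ℱ Y y) (h𝒢 : 𝒢.IsPolynomial) (n : ℕ)
    {s t : ℝ≥0} (hst : s ≤ t) :
    P[fun ω => monomialVec n (Y t ω) | ℱ s] =ᵐ[P] fun ω =>
      NormedSpace.exp (((t : ℝ) - s) • generatorMatrix h𝒢 n) *ᵥ monomialVec n (Y s ω) := by
  set U := (NormedSpace.exp (((t : ℝ) - s) • generatorMatrix h𝒢 n)).mulVecLin.toContinuousLinearMap
  have hint := hY.integrable_monomialVec h𝒢 n
  refine (ae_eq_condExp_of_forall_setIntegral_eq (ℱ.le s) (hint t)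
    (fun A _ _ => (U.integrable_comp (hint s)).integrableOn) (fun A hA _ => ?_) ?_).symm
  · exact (U.integral_comp_comm (hint s).restrict).trans
      (hY.setIntegral_monomialVec_eq_exp_mulVec h𝒢 n hst hA).symm
  · exact ((U.continuous.comp (continuous_monomialVec n)).comp_stronglyMeasurable
      (hY.stronglyAdapted s)).aestronglyMeasurable

theorem condExp_dotProduct_monomialVec (hY : IsJumpDiffusion 𝒢 P ℱ Y y) (h𝒢 : 𝒢.IsPolynomial)
    {n : ℕ} (c : Fin (n + 1) → ℝ) {s t : ℝ≥0} (hst : s ≤ t) :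
    P[fun ω => c ⬝ᵥ monomialVec n (Y t ω) | ℱ s] =ᵐ[P] fun ω =>
      c ⬝ᵥ (NormedSpace.exp (((t : ℝ) - s) • generatorMatrix h𝒢 n) *ᵥ monomialVec n (Y s ω)) := by
  refine (ContinuousLinearMap.comp_condExp_comm (hY.integrable_monomialVec h𝒢 n t)
    (dotProductBilin ℝ ℝ c).toContinuousLinearMap).symm.trans ?_
  filter_upwards [hY.condExp_monomialVec h𝒢 n hst] with ω hω
  exact congrArg (c ⬝ᵥ ·) hω

theorem condExp_eval (hY : IsJumpDiffusion 𝒢 P ℱ Y y) (h𝒢 : 𝒢.IsPolynomial)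
    {n : ℕ} {p : Polynomial ℝ} (hp : p ∈ Polynomial.degreeLE ℝ n) {s t : ℝ≥0} (hst : s ≤ t) :
    P[fun ω => p.eval (Y t ω) | ℱ s] =ᵐ[P] fun ω => coeffVec n p
      ⬝ᵥ (NormedSpace.exp (((t : ℝ) - s) • generatorMatrix h𝒢 n) *ᵥ monomialVec n (Y s ω)) := by
  simpa only [coeffVec_dotProduct_monomialVec hp] using
    hY.condExp_dotProduct_monomialVec h𝒢 (coeffVec n p) hst

end IsJumpDiffusion

/-! ### The correlator formula -/

theorem dupMatrix_mulVec_apply (n : ℕ) (v : Fin (2 * n + 1) → ℝ) (i j : Fin (n + 1)) :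
    (dupMatrix n *ᵥ v) (j, i) = v ⟨i + j, by omega⟩ := by
  simp only [dupMatrix, Matrix.sum_mulVec, Matrix.single_mulVec, one_mul, Finset.sum_apply,
    Function.update_apply, Prod.mk.injEq, Pi.zero_apply]
  rw [Finset.sum_eq_single i, Finset.sum_eq_single j]
  all_goals simp +contextual [eq_comm]

theorem dupMatrix_mulVec_monomialVec (n : ℕ) (x : ℝ) :
    dupMatrix n *ᵥ monomialVec (2 * n) x = (hankelMatrix n x).vec := by
  ext ⟨j, i⟩
  rw [dupMatrix_mulVec_apply]
  exact pow_add x i j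

theorem elimMatrix_mulVec_hankelMatrix (n : ℕ) (x : ℝ) :
    elimMatrix n *ᵥ (hankelMatrix n x).vec = monomialVec (2 * n) x := by
  ext k
  simp only [elimMatrix, Matrix.add_mulVec, Matrix.sum_mulVec, Matrix.single_mulVec, one_mul,
    Pi.add_apply, Finset.sum_apply, Function.update_apply, Pi.zero_apply, Matrix.vec, hankelMatrix,
    Matrix.vecMulVec_apply, monomialVec, Fin.ext_iff]
  rcases lt_or_ge (k : ℕ) (n + 1) with hk | hk
  · rw [Finset.sum_eq_single ⟨k, hk⟩, Finset.sum_eq_zero]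
    · simp
    · exact fun i _ => if_neg (by omega)
    · exact fun i _ hi => if_neg fun h => hi (Fin.ext h.symm)
    · simp
  · rw [Finset.sum_eq_zero fun i _ => if_neg (by omega),
      Finset.sum_eq_single ⟨k - (n + 1), by omega⟩]
    · rw [if_pos (by simp only; omega), zero_add, Fin.val_last, Fin.val_succ, ← pow_add]
      congr 1
      simp only
      omega
    · exact fun i _ hi => if_neg fun h => hi (Fin.ext (by simp only; omega))
    · simp

theorem dotProduct_vecInv_mulVec {m n : ℕ} (a : Fin m → ℝ) (v : Fin n × Fin m → ℝ)
    (w : Fin n → ℝ) : a ⬝ᵥ (vecInv v *ᵥ w) = (Matrix.vecMulVec a w).vec ⬝ᵥ v := by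
  simp only [dotProduct, Matrix.mulVec, Finset.mul_sum, Fintype.sum_prod_type_right, Matrix.vec,
    Matrix.vecMulVec_apply, vecInv, Matrix.of_apply]
  exact Finset.sum_congr rfl fun i _ => Finset.sum_congr rfl fun j _ => by ring

theorem vec_vecMulVec_dotProduct_vec_hankelMatrix {n : ℕ} (a w : Fin (n + 1) → ℝ) (x : ℝ) :
    (Matrix.vecMulVec a w).vec ⬝ᵥ (hankelMatrix n x).vec
      = a ⬝ᵥ monomialVec n x * w ⬝ᵥ monomialVec n x := by
  rw [← dotProduct_vecInv_mulVec, vecInv_vec, hankelMatrix, Matrix.vecMulVec_mulVec,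
    op_smul_eq_smul, dotProduct_smul, smul_eq_mul, mul_comm, dotProduct_comm _ w]

namespace IsJumpDiffusion

open JumpDiffusionOperator

variable {Ω : Type*} {mΩ : MeasurableSpace Ω} {𝒢 : JumpDiffusionOperator} {P : Measure Ω}
  {ℱ : Filtration ℝ≥0 mΩ} {Y : ℝ≥0 → Ω → ℝ} {y : ℝ}

theorem stronglyMeasurable_eval (hY : IsJumpDiffusion 𝒢 P ℱ Y y) (p : Polynomial ℝ) (t : ℝ≥0) :
    StronglyMeasurable[ℱ t] fun ω => p.eval (Y t ω) :=
  p.continuous.comp_stronglyMeasurable (hY.stronglyAdapted t)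

variable [IsProbabilityMeasure P]

theorem condExp_dotProduct_mul_dotProduct (hY : IsJumpDiffusion 𝒢 P ℱ Y y) (h𝒢 : 𝒢.IsPolynomial)
    {n : ℕ} (a w : Fin (n + 1) → ℝ) {s t : ℝ≥0} (hst : s ≤ t) :
    P[fun ω => a ⬝ᵥ monomialVec n (Y t ω) * w ⬝ᵥ monomialVec n (Y t ω) | ℱ s] =ᵐ[P] fun ω =>
      a ⬝ᵥ (vecInv ((dupMatrix n * NormedSpace.exp (((t : ℝ) - s) • generatorMatrix h𝒢 (2 * n))
        * elimMatrix n) *ᵥ (hankelMatrix n (Y s ω)).vec) *ᵥ w) := by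
  simpa only [← Matrix.dotProduct_mulVec, dupMatrix_mulVec_monomialVec,
    vec_vecMulVec_dotProduct_vec_hankelMatrix, ← Matrix.mulVec_mulVec,
    elimMatrix_mulVec_hankelMatrix, dotProduct_vecInv_mulVec] using
    hY.condExp_dotProduct_monomialVec h𝒢 ((Matrix.vecMulVec a w).vec ᵥ* dupMatrix n) hst

theorem integrable_eval_mul_eval (hY : IsJumpDiffusion 𝒢 P ℱ Y y) (h𝒢 : 𝒢.IsPolynomial)
    (p q : Polynomial ℝ) (s t : ℝ≥0) :
    Integrable (fun ω => p.eval (Y s ω) * q.eval (Y t ω)) P := by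
  have hmemLp (p : Polynomial ℝ) (s : ℝ≥0) : MemLp (fun ω => p.eval (Y s ω)) 2 P := by
    have hsq := hY.integrable_eval h𝒢 (p ^ 2) s
    simp only [Polynomial.eval_pow] at hsq
    exact (memLp_two_iff_integrable_sq
      ((hY.stronglyMeasurable_eval p s).mono (ℱ.le s)).aestronglyMeasurable).2 hsq
  exact (hmemLp p s).integrable_mul (hmemLp q t)

theorem condExp_eval_mul_eval (hY : IsJumpDiffusion 𝒢 P ℱ Y y) (h𝒢 : 𝒢.IsPolynomial) {n : ℕ}
    {p q : Polynomial ℝ} (hp : p ∈ Polynomial.degreeLE ℝ n) (hq : q ∈ Polynomial.degreeLE ℝ n)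
    {s t : ℝ≥0} (hst : s ≤ t) :
    P[fun ω => p.eval (Y s ω) * q.eval (Y t ω) | ℱ s] =ᵐ[P] fun ω =>
      coeffVec n p ⬝ᵥ monomialVec n (Y s ω)
        * (NormedSpace.exp (((t : ℝ) - s) • (generatorMatrix h𝒢 n)ᵀ) *ᵥ coeffVec n q)
          ⬝ᵥ monomialVec n (Y s ω) := by
  refine (condExp_mul_of_stronglyMeasurable_left (hY.stronglyMeasurable_eval p s)
    (hY.integrable_eval_mul_eval h𝒢 p q s t) (hY.integrable_eval h𝒢 q t)).trans ?_
  filter_upwards [hY.condExp_eval h𝒢 hq hst] with ω hω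
  rw [Pi.mul_apply, hω, coeffVec_dotProduct_monomialVec hp, ← Matrix.transpose_smul,
    Matrix.exp_transpose, Matrix.mulVec_transpose, Matrix.dotProduct_mulVec]

end IsJumpDiffusion

theorem theorem3p9 {Ω : Type*} {mΩ : MeasurableSpace Ω} (P : Measure Ω) [IsProbabilityMeasure P]
    (ℱ : Filtration ℝ≥0 mΩ) (𝒢 : JumpDiffusionOperator) (h𝒢 : 𝒢.IsPolynomial)
    (Y : ℝ≥0 → Ω → ℝ) (y : ℝ) (hY : IsJumpDiffusion 𝒢 P ℱ Y y)
    (n₀ n₁ n : ℕ) (hn : n = max n₀ n₁)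
    (p₀ p₁ : Polynomial ℝ) (hp₀ : p₀ ∈ Polynomial.degreeLE ℝ n₀)
    (hp₁ : p₁ ∈ Polynomial.degreeLE ℝ n₁)
    (t s₀ s₁ : ℝ≥0) (hts : t < s₀) (hss : s₀ < s₁) :
    Integrable (fun ω => p₁.eval (Y s₀ ω) * p₀.eval (Y s₁ ω)) P ∧
    P[fun ω => p₁.eval (Y s₀ ω) * p₀.eval (Y s₁ ω) | ℱ t] =ᵐ[P] fun ω =>
      coeffVec n p₁ ⬝ᵥ
        ((vecInv ((dupMatrix n
              * NormedSpace.exp (((s₀ : ℝ) - t) • JumpDiffusionOperator.generatorMatrix h𝒢 (2 * n))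
              * elimMatrix n) *ᵥ (hankelMatrix n (Y t ω)).vec)
          * NormedSpace.exp (((s₁ : ℝ) - s₀) • (JumpDiffusionOperator.generatorMatrix h𝒢 n)ᵀ))
        *ᵥ coeffVec n p₀) := by
  have hp₀n : p₀ ∈ Polynomial.degreeLE ℝ n :=
    Polynomial.degreeLE_mono (Nat.cast_le.2 (hn ▸ le_max_left n₀ n₁)) hp₀
  have hp₁n : p₁ ∈ Polynomial.degreeLE ℝ n :=
    Polynomial.degreeLE_mono (Nat.cast_le.2 (hn ▸ le_max_right n₀ n₁)) hp₁
  refine ⟨hY.integrable_eval_mul_eval h𝒢 p₁ p₀ s₀ s₁, ?_⟩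
  have htower := condExp_condExp_of_le (μ := P)
    (f := fun ω => p₁.eval (Y s₀ ω) * p₀.eval (Y s₁ ω)) (ℱ.mono hts.le) (ℱ.le s₀)
  have hlast := condExp_congr_ae (m := ℱ t) (hY.condExp_eval_mul_eval h𝒢 hp₁n hp₀n hss.le)
  simpa only [Matrix.mulVec_mulVec] using
    (htower.symm.trans hlast).trans (hY.condExp_dotProduct_mul_dotProduct h𝒢 _ _ hts.le)
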